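/- Let $p$ be an odd prime, $F_q$ a finite field of characteristic $p$ with $q$ elements, $n\ge 1$, and $F$ a field of characteristic different from $p$ that contains a non-trivial $p$-th root of unity. Let $V$ be the symplectic space over $F_q$ with symplectic basis $u_1,\dots,u_n,v_1,\dots,v_n$ (so $\langle u_i,v_j\rangle=\delta_{ij}$, $\langle u_i,u_j\rangle=\langle v_i,v_j\rangle=0$), $M=\mathrm{span}\{u_i\}$, $N=\mathrm{span}\{v_i\}$, and let $\mathrm{Sp}$ be the symplectic group of $V$. Let $Y$ be an $F$-vector space with basis $(\epsilon_w)_{w\in N}$. For a non-trivial linear character $\lambda:F_q^+\to F^*$ let $J$ be the representation on $Y$ of the Heisenberg group $F_q\times V$, with multiplication $(\alpha,x)(\beta,y)=(\alpha+\beta+\langle x,y\rangle,x+y)$, given by $$J(\alpha,u+v)\epsilon_w=\lambda(\alpha+\langle u,v+2w\rangle)\,\epsilon_{w+v},\qquad \alpha\in F_q,\ u\in M,\ v,w\in N.$$ The Weil representation of type $\lambda$ is the representation $P:\mathrm{Sp}\to\mathrm{GL}(Y)$ such that $P(g)J(\alpha,x)P(g)^{-1}=J(\alpha,gx)$ for all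 $g\in\mathrm{Sp}$, $\alpha\in F_q$, $x\in V$, and $$P(\rho)\epsilon_w=\Big(\sum_{\alpha\in F_q}\lambda(\alpha^2)\Big)^{-1}\sum_{\alpha\in F_q}\lambda(\alpha^2)\,\epsilon_{w+\alpha v_n}\quad(w\in N),\qquad\text{where }\rho(x)=x-\langle v_n,x\rangle v_n.$$ The Weil modules of type $\lambda$ are the subspaces $Y^-_\lambda=\mathrm{span}\{\epsilon_w-\epsilon_{-w}: w\ne0\}$ and $Y^+_\lambda\oplus Y_0$, with $Y^+_\lambda=\mathrm{span}\{\epsilon_w+\epsilon_{-w}: w\neq 0\}$ and $Y_0=F\epsilon_0$, with $\mathrm{Sp}$ acting through $P$. For $\kappa\in F_q^*$ put $\lambda[\kappa](\alpha)=\lambda(\kappa\alpha)$. Theorem. For every non-trivial $\lambda$ the Weil representation of type $\lambda$ exists and is unique, and $Y^-_\lambda$ and $Y^+_\lambda\oplus Y_0$ are $\mathrm{Sp}$-submodules of it, of degrees $(q^n-1)/2$ and $(q^n+1)/2$ respectively. As $\lambda$ runs through all non-trivial linear characters of $F_q^+$, the Weil modules of degree $(q^n-1)/2$ form exactly two isomorphism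 classes of $F\mathrm{Sp}$-modules, and so do those of degree $(q^n+1)/2$. For each of the two degrees and every $\kappa\in F_q^*$, the Weil modules of types $\lambda$ and $\lambda[\kappa]$ are isomorphic if and only if $\kappa$ is a square. -/

import Mathlib

noncomputable section

namespace WeilModules

open Matrix

/-- The symplectic space `V` of dimension `2n` over `K`, in coordinates with respect to a fixed
symplectic basis `u₁, …, uₙ, v₁, …, vₙ`: the coordinate `Sum.inl i` belongs to `uᵢ` and the
coordinate `Sum.inr i` belongs to `vᵢ`. The group `Sp` of this space is
`Matrix.symplecticGroup (Fin n) K`, acting by `Matrix.mulVec`. -/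
abbrev SpaceV (n : ℕ) (K : Type*) : Type _ := Fin n ⊕ Fin n → K

/-- The Lagrangian subspace `N = span {v₁, …, vₙ}`, in coordinates. -/
abbrev SpaceN (n : ℕ) (K : Type*) : Type _ := Fin n → K

/-- The alternating form with `⟨uᵢ, vⱼ⟩ = δᵢⱼ` and `⟨uᵢ, uⱼ⟩ = ⟨vᵢ, vⱼ⟩ = 0`. -/
def sympForm {n : ℕ} {K : Type*} [Field K] (x y : SpaceV n K) : K :=
  ∑ i, (x (Sum.inl i) * y (Sum.inr i) - x (Sum.inr i) * y (Sum.inl i))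

theorem J_mulVec_dotProduct {n : ℕ} {K : Type*} [Field K] (x y : SpaceV n K) :
    (J (Fin n) K *ᵥ x) ⬝ᵥ y = sympForm x y := by
  simp [J, sympForm, dotProduct, fromBlocks_mulVec, Fintype.sum_sum_type, Finset.sum_sub_distrib,
    Function.comp_def, neg_mulVec]
  ring

/-- `Sp` is the group of all matrices that preserve the form. -/
theorem mem_symplecticGroup_iff_sympForm {n : ℕ} {K : Type*} [Field K]
    (A : Matrix (Fin n ⊕ Fin n) (Fin n ⊕ Fin n) K) :
    A ∈ symplecticGroup (Fin n) K ↔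
      ∀ x y : SpaceV n K, sympForm (A *ᵥ x) (A *ᵥ y) = sympForm x y := by
  have key : ∀ x y : SpaceV n K,
      sympForm (A *ᵥ x) (A *ᵥ y) = ((Aᵀ * J (Fin n) K * A) *ᵥ x) ⬝ᵥ y := by
    intro x y
    rw [← J_mulVec_dotProduct, dotProduct_mulVec, ← mulVec_transpose, mulVec_mulVec,
      mulVec_mulVec, Matrix.mul_assoc]
  rw [SymplecticGroup.mem_iff']
  constructor
  · intro h x y
    rw [key, h, J_mulVec_dotProduct]
  · intro h
    refine Matrix.ext_of_mulVec_single fun i => ?_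
    refine dotProduct_eq _ _ fun y => ?_
    rw [← key, h, J_mulVec_dotProduct]

theorem one_add_smul_vecMulVec_mulVec {n : ℕ} {K : Type*} [Field K] (u : SpaceV n K) (α : K)
    (x : SpaceV n K) :
    (1 + α • vecMulVec u (J (Fin n) K *ᵥ u)) *ᵥ x = x + (α * sympForm u x) • u := by
  rw [add_mulVec, one_mulVec, smul_mulVec, vecMulVec_mulVec, J_mulVec_dotProduct, mul_smul]
  simp

/-- The symplectic transvection `ρ_{u,α}`, the map `x ↦ x + α ⟨u, x⟩ u`. -/
def transvection {n : ℕ} {K : Type*} [Field K] (u : SpaceV n K) (α : K) :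
    symplecticGroup (Fin n) K :=
  ⟨1 + α • vecMulVec u (J (Fin n) K *ᵥ u), by
    rw [mem_symplecticGroup_iff_sympForm]
    intro x y
    simp only [one_add_smul_vecMulVec_mulVec, sympForm, Pi.add_apply, Pi.smul_apply, smul_eq_mul]
    set a := ∑ i, (u (Sum.inl i) * x (Sum.inr i) - u (Sum.inr i) * x (Sum.inl i)) with ha
    set b := ∑ i, (u (Sum.inl i) * y (Sum.inr i) - u (Sum.inr i) * y (Sum.inl i)) with hb
    have h : α * a * b - α * b * a = 0 := by ring
    have h2 : α * a * b - α * b * a =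
        α * a * (∑ i, (u (Sum.inl i) * y (Sum.inr i) - u (Sum.inr i) * y (Sum.inl i))) -
        α * b * (∑ i, (u (Sum.inl i) * x (Sum.inr i) - u (Sum.inr i) * x (Sum.inl i))) := by
      rw [← ha, ← hb]
    clear_value a b
    rw [← sub_eq_zero, ← Finset.sum_sub_distrib, ← h, h2]
    rw [Finset.mul_sum, Finset.mul_sum, ← Finset.sum_sub_distrib]
    refine Finset.sum_congr rfl fun i _ => ?_
    ring⟩

theorem transvection_mulVec {n : ℕ} {K : Type*} [Field K] (u : SpaceV n K) (α : K)
    (x : SpaceV n K) :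
    (transvection u α).1 *ᵥ x = x + (α * sympForm u x) • u :=
  one_add_smul_vecMulVec_mulVec u α x

/-- The space `Y` with basis `(ε_w)` indexed by `w ∈ N`. -/
abbrev SpaceY (n : ℕ) (K F : Type*) [Field F] : Type _ := SpaceN n K →₀ F

/-- The basis vector `ε_w` of `Y`. -/
def eps {n : ℕ} {K : Type*} (F : Type*) [Field F] (w : SpaceN n K) : SpaceY n K F :=
  Finsupp.single w 1

/-- The operator `J(α, x)` by which the element `(α, x)` of the Heisenberg group `K × V`, with
multiplication `(α, x)(β, y) = (α + β + ⟨x, y⟩, x + y)`, acts on `Y`: if `x = u + v` with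
`u ∈ M = span {u₁, …, uₙ}` and `v ∈ N` then `J(α, x) ε_w = ψ(α + ⟨u, v + 2w⟩) ε_{w + v}`.
In coordinates the form between `M` and `N` is the dot product. -/
def heisenbergOp {n : ℕ} {K F : Type*} [Field K] [Field F] (ψ : AddChar K F)
    (α : K) (x : SpaceV n K) : SpaceY n K F →ₗ[F] SpaceY n K F :=
  Finsupp.linearCombination F fun w : SpaceN n K =>
    ψ (α + (x ∘ Sum.inl) ⬝ᵥ (x ∘ Sum.inr + 2 • w)) • eps F (w + x ∘ Sum.inr)

/-- The Heisenberg group acts on `Y` through `J`. -/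
theorem heisenbergOp_mul {n : ℕ} {K F : Type*} [Field K] [Field F] (ψ : AddChar K F)
    (α β : K) (x y : SpaceV n K) :
    heisenbergOp ψ α x * heisenbergOp ψ β y =
      (heisenbergOp ψ (α + β + sympForm x y) (x + y) : Module.End F (SpaceY n K F)) := by
  refine Finsupp.lhom_ext' fun w => LinearMap.ext_ring ?_
  have h : (α + (x ∘ Sum.inl) ⬝ᵥ (x ∘ Sum.inr + 2 • (w + y ∘ Sum.inr))) +
      (β + (y ∘ Sum.inl) ⬝ᵥ (y ∘ Sum.inr + 2 • w)) =
      α + β + sympForm x y +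
        ((x + y) ∘ Sum.inl) ⬝ᵥ ((x + y) ∘ Sum.inr + 2 • w) := by
    have h1 : ∀ a b c d : K, a + b + (c + d) = a + c + (b + d) := fun _ _ _ _ => by ring
    rw [h1, add_assoc (α + β)]
    simp only [sympForm, dotProduct, ← Finset.sum_add_distrib]
    refine congrArg _ (Finset.sum_congr rfl fun i _ => ?_)
    simp only [Function.comp_apply, Pi.add_apply, two_nsmul]
    ring
  have h' : w + y ∘ Sum.inr + x ∘ Sum.inr = w + (x + y) ∘ Sum.inr := by
    rw [add_assoc, add_comm (y ∘ Sum.inr)]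
    rfl
  simp only [heisenbergOp, eps, LinearMap.comp_apply, Module.End.mul_apply,
    Finsupp.lsingle_apply, Finsupp.linearCombination_single, map_smul, smul_smul, one_mul]
  rw [mul_comm, ← AddChar.map_add_eq_mul, h, h']

/-- The basis vector `vₙ`, as an element of `N`. -/
def vLast (n : ℕ) [NeZero n] (K : Type*) [Field K] : SpaceN n K := Pi.single ⊤ 1

/-- The representation `P` of `Sp` on `Y` is the Weil representation of type `ψ`: it satisfies
`P(g) J(α, x) P(g)⁻¹ = J(α, g x)` for all `g`, and
`P(ρ_{vₙ,-1}) ε_w = (∑_α ψ(α²))⁻¹ ∑_α ψ(α²) ε_{w + α vₙ}`. The second condition singles out one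
of the three solutions of the first when `(n, |K|) = (1, 3)`; otherwise the first condition has
only one solution and the second one is a consequence of it. -/
structure IsWeilRepresentation {n : ℕ} [NeZero n] {K F : Type*} [Field K] [Fintype K] [Field F]
    (ψ : AddChar K F) (P : Representation F (symplecticGroup (Fin n) K) (SpaceY n K F)) :
    Prop where
  conj : ∀ (g : symplecticGroup (Fin n) K) (α : K) (x : SpaceV n K),
    P g * heisenbergOp ψ α x * P g⁻¹ = heisenbergOp ψ α (g.1 *ᵥ x)
  transvection_eps : ∀ w : SpaceN n K,
    P (transvection (Sum.elim 0 (vLast n K)) (-1)) (eps F w) =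
      (∑ α : K, ψ (α ^ 2))⁻¹ • ∑ α : K, ψ (α ^ 2) • eps F (w + α • vLast n K)

/-- `Y₀`, the line spanned by `ε_0`. -/
def yZero (n : ℕ) (K F : Type*) [Field K] [Field F] : Submodule F (SpaceY n K F) :=
  Submodule.span F {eps F 0}

/-- `Y⁺`, the span of the vectors `ε_w + ε_{-w}` with `w ≠ 0`. -/
def yPlus (n : ℕ) (K F : Type*) [Field K] [Field F] : Submodule F (SpaceY n K F) :=
  Submodule.span F {y | ∃ w : SpaceN n K, w ≠ 0 ∧ y = eps F w + eps F (-w)}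

/-- `Y⁻`, the span of the vectors `ε_w - ε_{-w}` with `w ≠ 0`. -/
def yMinus (n : ℕ) (K F : Type*) [Field K] [Field F] : Submodule F (SpaceY n K F) :=
  Submodule.span F {y | ∃ w : SpaceN n K, w ≠ 0 ∧ y = eps F w - eps F (-w)}

/-- The Weil modules of `Sp` over `F` on the subspace `W` of `Y`, one for each type: a type, the
Weil representation of this type on `Y`, and `W` as a subrepresentation of it. -/
structure WeilModule {n : ℕ} [NeZero n] {K F : Type*} [Field K] [Fintype K] [Field F]
    (W : Submodule F (SpaceY n K F)) where
  /-- the type, a non-trivial linear character of the additive group of `K` -/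
  type : AddChar K F
  type_ne_one : type ≠ 1
  /-- the Weil representation of this type -/
  rep : Representation F (symplecticGroup (Fin n) K) (SpaceY n K F)
  isWeil : IsWeilRepresentation type rep
  /-- the subrepresentation carried by `W` -/
  sub : Subrepresentation rep
  sub_eq : sub.toSubmodule = W

/-- The Weil modules of degree `(q ^ n - 1) / 2`: they are carried by `Y⁻`. -/
abbrev WeilModuleMinus (n : ℕ) [NeZero n] (K F : Type*) [Field K] [Fintype K] [Field F] :=
  WeilModule (yMinus n K F)

/-- The Weil modules of degree `(q ^ n + 1) / 2`: they are carried by `Y⁺ ⊕ Y₀`. -/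
abbrev WeilModulePlus (n : ℕ) [NeZero n] (K F : Type*) [Field K] [Fintype K] [Field F] :=
  WeilModule (yPlus n K F ⊔ yZero n K F)

/-- Isomorphism of Weil modules as `F Sp`-modules. -/
def WeilModule.Iso {n : ℕ} [NeZero n] {K F : Type*} [Field K] [Fintype K] [Field F]
    {W : Submodule F (SpaceY n K F)} (A B : WeilModule W) : Prop :=
  Nonempty (A.sub.toRepresentation.Equiv B.sub.toRepresentation)

end WeilModules

end

/-! By Schur's lemma for `J`, the operators that realise a given `g` in `Sp` are determined up to a
scalar. They exist: `Sp` is generated by transvections, and for `ρ_{u,α}` with `α ≠ 0` the Gaussian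
sum `transvectionOp` of Heisenberg operators is an intertwiner, invertible because `q ≠ 0` in `F`.
All intertwiners built this way commute with the reflection `ε_w ↦ ε_{-w}`, hence preserve `Y⁻` and
`Y⁺ ⊕ Y₀`.

The scalars are fixed by determinants. The two subspaces have dimensions `m` and `m + 1`, so
multiplying `T` by `c` multiplies `det(T|Y⁻) / det(T|Y⁺ ⊕ Y₀)` by `c⁻¹`. Multiplying `T` by this
quotient therefore gives an operator that depends only on `g` and is multiplicative in `g`. The
Gauss sum in the value at `ρ` comes from comparing eigenvalues on one vector
(`weilRep_transvection_vLast`). Conversely, this value determines the representation, since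
`ρ_{u,α}` is a product of two transvections with coefficient `-1` and those along nonzero vectors
are conjugate.

For the classification, `ε_w ↦ ε_{aw}` carries type `ψ[a²]` to type `ψ`, so a square shift does not
change the class. In the other direction, `ρ_{uₙ,α}` acts diagonally with eigenvalues `ψ(α wₙ²)`.
The eigencharacter `ψ` occurs in both Weil modules of type `ψ`; it occurs in type `ψ[κ]` only if `κ
wₙ² = 1` for some `wₙ`, that is, only if `κ` is a square. Every character is a shift of a given
non-trivial one, and nonzero elements of `K` form two classes modulo squares. -/

noncomputable section

namespace WeilModules

open Matrix

/-! ### Symplectic geometry: generation by transvections -/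

section Symplectic

variable {n : ℕ} {K : Type*} [Field K]

theorem sympForm_add_left (x y z : SpaceV n K) :
    sympForm (x + y) z = sympForm x z + sympForm y z := by
  simp only [sympForm, ← Finset.sum_add_distrib, Pi.add_apply]
  exact Finset.sum_congr rfl fun i _ => by ring

theorem sympForm_swap (x y : SpaceV n K) : sympForm y x = -sympForm x y := by
  simp only [sympForm, ← Finset.sum_neg_distrib]
  exact Finset.sum_congr rfl fun i _ => by ring

theorem sympForm_self (x : SpaceV n K) : sympForm x x = 0 := by
  simp only [sympForm]
  exact Finset.sum_eq_zero fun i _ => by ring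

theorem sympForm_smul_left (c : K) (x y : SpaceV n K) :
    sympForm (c • x) y = c * sympForm x y := by
  simp only [sympForm, Finset.mul_sum, Pi.smul_apply, smul_eq_mul]
  exact Finset.sum_congr rfl fun i _ => by ring

theorem sympForm_add_right (x y z : SpaceV n K) :
    sympForm x (y + z) = sympForm x y + sympForm x z := by
  rw [sympForm_swap, sympForm_add_left, sympForm_swap x, sympForm_swap x, neg_add, neg_neg, neg_neg]

theorem sympForm_smul_right (c : K) (x y : SpaceV n K) :
    sympForm x (c • y) = c * sympForm x y := by
  rw [sympForm_swap, sympForm_smul_left, sympForm_swap x, mul_neg, neg_neg]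

theorem sympForm_sub_left (x y z : SpaceV n K) :
    sympForm (x - y) z = sympForm x z - sympForm y z := by
  rw [eq_sub_iff_add_eq, ← sympForm_add_left, sub_add_cancel]

theorem sympForm_mulVec (g : symplecticGroup (Fin n) K) (x y : SpaceV n K) :
    sympForm (g.1 *ᵥ x) (g.1 *ᵥ y) = sympForm x y :=
  (mem_symplecticGroup_iff_sympForm g.1).1 g.2 x y

theorem mul_mulVec (g h : symplecticGroup (Fin n) K) (x : SpaceV n K) :
    (g * h).1 *ᵥ x = g.1 *ᵥ (h.1 *ᵥ x) := by
  rw [mulVec_mulVec]; rfl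

theorem mulVec_inv_mulVec (g : symplecticGroup (Fin n) K) (x : SpaceV n K) :
    g.1 *ᵥ ((g⁻¹).1 *ᵥ x) = x := by
  rw [← mul_mulVec, mul_inv_cancel]; exact one_mulVec x

theorem symplectic_ext {g h : symplecticGroup (Fin n) K}
    (H : ∀ x : SpaceV n K, g.1 *ᵥ x = h.1 *ᵥ x) : g = h :=
  Subtype.ext (Matrix.ext_of_mulVec_single fun _ => H _)

theorem transvection_add (u : SpaceV n K) (α β : K) :
    transvection u (α + β) = transvection u α * transvection u β := by
  refine symplectic_ext fun x => ?_
  rw [mul_mulVec]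
  simp only [transvection_mulVec, sympForm_add_right, sympForm_smul_right, sympForm_self]
  module

theorem transvection_zero (u : SpaceV n K) : transvection u (0 : K) = 1 := by
  refine symplectic_ext fun x => ?_
  rw [transvection_mulVec, zero_mul, zero_smul, add_zero]
  exact (one_mulVec x).symm

theorem transvection_zero_left (α : K) : transvection (0 : SpaceV n K) α = 1 := by
  refine symplectic_ext fun x => ?_
  rw [transvection_mulVec, smul_zero, add_zero]
  exact (one_mulVec x).symm

theorem transvection_smul (c : K) (u : SpaceV n K) (α : K) :
    transvection (c • u) α = transvection u (α * c ^ 2) := by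
  refine symplectic_ext fun x => ?_
  simp only [transvection_mulVec, sympForm_smul_left]
  module

theorem conj_transvection (g : symplecticGroup (Fin n) K) (u : SpaceV n K) (α : K) :
    g * transvection u α * g⁻¹ = transvection (g.1 *ᵥ u) α := by
  refine symplectic_ext fun x => ?_
  rw [mul_mulVec, mul_mulVec, transvection_mulVec, transvection_mulVec, mulVec_add,
    mulVec_inv_mulVec, mulVec_smul, ← sympForm_mulVec g, mulVec_inv_mulVec]

/-- The subgroup of `Sp` generated by the transvections. -/
def transvectionSubgroup (n : ℕ) (K : Type*) [Field K] : Subgroup (symplecticGroup (Fin n) K) :=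
  Subgroup.closure {g | ∃ (u : SpaceV n K) (α : K), g = transvection u α}

theorem transvection_mem (u : SpaceV n K) (α : K) :
    transvection u α ∈ transvectionSubgroup n K :=
  Subgroup.subset_closure ⟨u, α, rfl⟩

/-- Since `⟨x - y, x⟩ = ⟨x, y⟩`, the transvection along `x - y` with coefficient `-⟨x, y⟩⁻¹`
subtracts `x - y` from `x`. It fixes everything orthogonal to `x - y`. -/
theorem exists_transvection_of_sympForm_ne_zero {x y : SpaceV n K} (h : sympForm x y ≠ 0) :
    ∃ g ∈ transvectionSubgroup n K, g.1 *ᵥ x = y ∧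
      ∀ z, sympForm x z = sympForm y z → g.1 *ᵥ z = z := by
  refine ⟨_, transvection_mem (x - y) (-(sympForm x y)⁻¹), ?_, fun z hz => ?_⟩
  · rw [transvection_mulVec, sympForm_sub_left, sympForm_self, sympForm_swap x y]
    have : -(sympForm x y)⁻¹ * (0 - -sympForm x y) = -1 := by field_simp; ring
    rw [this]; module
  · rw [transvection_mulVec, sympForm_sub_left, hz, sub_self, mul_zero, zero_smul, add_zero]

/-- Two transvections suffice, through a vector `m` orthogonal to neither `x` nor `y`; one of `x'`,
`y'`, `x' + y'` is such an `m`. The control over `z` keeps hyperbolic pairs that are already in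
place fixed. -/
theorem exists_mulVec_eq {x y x' y' : SpaceV n K} (hx : sympForm x x' ≠ 0)
    (hy : sympForm y y' ≠ 0) :
    ∃ g ∈ transvectionSubgroup n K, g.1 *ᵥ x = y ∧
      ∀ z, sympForm x z = 0 → sympForm y z = 0 → sympForm x' z = 0 → sympForm y' z = 0 →
        g.1 *ᵥ z = z := by
  have key : ∀ m : SpaceV n K, sympForm x m ≠ 0 → sympForm y m ≠ 0 →
      (∀ z, sympForm x' z = 0 → sympForm y' z = 0 → sympForm m z = 0) →
      ∃ g ∈ transvectionSubgroup n K, g.1 *ᵥ x = y ∧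
      ∀ z, sympForm x z = 0 → sympForm y z = 0 → sympForm x' z = 0 → sympForm y' z = 0 →
        g.1 *ᵥ z = z := by
    intro m h1 h2 h3
    obtain ⟨g, hg, hgx, hgz⟩ := exists_transvection_of_sympForm_ne_zero h1
    obtain ⟨k, hk, hkx, hkz⟩ := exists_transvection_of_sympForm_ne_zero
      (x := m) (y := y) (by rwa [sympForm_swap, neg_ne_zero])
    refine ⟨k * g, mul_mem hk hg, by rw [mul_mulVec, hgx, hkx], fun z a b c d => ?_⟩
    rw [mul_mulVec, hgz z (by rw [a, h3 z c d]), hkz z (by rw [b, h3 z c d])]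
  by_cases h1 : sympForm y x' = 0
  · by_cases h2 : sympForm x y' = 0
    · refine key (x' + y') ?_ ?_ fun z a b => by rw [sympForm_add_left, a, b, add_zero]
      · rwa [sympForm_add_right, h2, add_zero]
      · rwa [sympForm_add_right, h1, zero_add]
    · exact key y' h2 hy fun z _ b => b
  · exact key x' hx h1 fun z a _ => a

/-- If `⟨x, y⟩ ≠ 0`, the transvection along `x - y` fixes `u`, because `⟨u, x - y⟩ = 0`. Otherwise
the detour through `u + x` works: it also pairs to 1 with `u` and is orthogonal to neither `x` nor
`y`. -/
theorem exists_mulVec_eq_of_fixed {u x y : SpaceV n K} (hx : sympForm u x = 1)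
    (hy : sympForm u y = 1) :
    ∃ g ∈ transvectionSubgroup n K, g.1 *ᵥ u = u ∧ g.1 *ᵥ x = y ∧
      ∀ z, sympForm u z = 0 → sympForm x z = 0 → sympForm y z = 0 → g.1 *ᵥ z = z := by
  have hx' : sympForm x u = -1 := by rw [sympForm_swap, hx]
  have hy' : sympForm y u = -1 := by rw [sympForm_swap, hy]
  by_cases h : sympForm x y = 0
  · obtain ⟨g, hg, hgx, hgz⟩ := exists_transvection_of_sympForm_ne_zero (x := x) (y := u + x)
      (by rw [sympForm_add_right, sympForm_self, hx']; simp)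
    obtain ⟨k, hk, hkx, hkz⟩ := exists_transvection_of_sympForm_ne_zero (x := u + x) (y := y)
      (by rw [sympForm_add_left, h, hy]; simp)
    refine ⟨k * g, mul_mem hk hg, ?_, by rw [mul_mulVec, hgx, hkx], fun z a b c => ?_⟩
    · rw [mul_mulVec, hgz u (by rw [sympForm_add_left, sympForm_self, zero_add]),
        hkz u (by rw [sympForm_add_left, sympForm_self, zero_add, hx', hy'])]
    · rw [mul_mulVec, hgz z (by rw [sympForm_add_left, a, zero_add]),
        hkz z (by rw [sympForm_add_left, a, b, c, zero_add])]
  · obtain ⟨g, hg, hgx, hgz⟩ := exists_transvection_of_sympForm_ne_zero h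
    exact ⟨g, hg, hgz u (by rw [hx', hy']), hgx, fun z _ b c => hgz z (by rw [b, c])⟩

theorem sympForm_single_inl (i : Fin n) (x : SpaceV n K) :
    sympForm (Pi.single (Sum.inl i) 1) x = x (Sum.inr i) := by
  simp [sympForm, Pi.single_apply]

theorem sympForm_single_inr (i : Fin n) (x : SpaceV n K) :
    sympForm (Pi.single (Sum.inr i) 1) x = -x (Sum.inl i) := by
  simp [sympForm, Pi.single_apply]

theorem exists_sympForm_ne_zero {x : SpaceV n K} (hx : x ≠ 0) : ∃ y, sympForm x y ≠ 0 := by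
  obtain ⟨i | i, hi⟩ := Function.ne_iff.1 hx
  · exact ⟨Pi.single (Sum.inr i) 1, by rw [sympForm_swap, sympForm_single_inr, neg_neg]; exact hi⟩
  · exact ⟨Pi.single (Sum.inl i) 1, by
      rw [sympForm_swap, sympForm_single_inl, neg_ne_zero]; exact hi⟩

theorem exists_symplectic_mulVec_eq {x y : SpaceV n K} (hx : x ≠ 0) (hy : y ≠ 0) :
    ∃ g : symplecticGroup (Fin n) K, g.1 *ᵥ x = y := by
  obtain ⟨x', hx'⟩ := exists_sympForm_ne_zero hx
  obtain ⟨y', hy'⟩ := exists_sympForm_ne_zero hy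
  obtain ⟨g, -, hg, -⟩ := exists_mulVec_eq hx' hy'
  exact ⟨g, hg⟩

/-- Witt-style induction: one hyperbolic pair at a time is moved back to its place. The pairs
treated earlier are orthogonal to the new pair and to its image, so the new transvections leave them
fixed. -/
theorem exists_mul_fixes (g : symplecticGroup (Fin n) K) (s : Finset (Fin n)) :
    ∃ h ∈ transvectionSubgroup n K, ∀ i ∈ s,
      (h * g).1 *ᵥ (Pi.single (Sum.inl i) 1 : SpaceV n K) = Pi.single (Sum.inl i) 1 ∧
      (h * g).1 *ᵥ (Pi.single (Sum.inr i) 1 : SpaceV n K) = Pi.single (Sum.inr i) 1 := by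
  induction s using Finset.induction_on with
  | empty => exact ⟨1, one_mem _, by simp⟩
  | insert k s hk ih =>
    obtain ⟨h, hh, hs⟩ := ih
    have ne : ∀ i ∈ s, k ≠ i := fun i hi e => hk (e ▸ hi)
    set a : Fin n → SpaceV n K := fun i => Pi.single (Sum.inl i) 1 with ha
    set b : Fin n → SpaceV n K := fun i => Pi.single (Sum.inr i) 1 with hb
    have hab : sympForm (a k) (b k) = 1 := by simp [ha, hb, sympForm_single_inl]
    have haa : ∀ i ∈ s, sympForm (a k) (a i) = 0 := fun i hi => by
      simp [ha, sympForm_single_inl]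
    have hab' : ∀ i ∈ s, sympForm (a k) (b i) = 0 := fun i hi => by
      simp [ha, hb, sympForm_single_inl, ne i hi]
    have hba : ∀ i ∈ s, sympForm (b k) (a i) = 0 := fun i hi => by
      simp [ha, hb, sympForm_single_inr, ne i hi]
    have hbb : ∀ i ∈ s, sympForm (b k) (b i) = 0 := fun i hi => by
      simp [hb, sympForm_single_inr]
    have mv : ∀ (l : symplecticGroup (Fin n) K) (x y : SpaceV n K), l.1 *ᵥ y = y →
        sympForm x y = 0 → sympForm (l.1 *ᵥ x) y = 0 := by
      intro l x y e e'
      rw [← e, sympForm_mulVec, e']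
    obtain ⟨h₁, hh₁, e₁, f₁⟩ := exists_mulVec_eq (x := (h * g).1 *ᵥ a k) (y := a k)
      (x' := (h * g).1 *ᵥ b k) (y' := b k) (by rw [sympForm_mulVec, hab]; exact one_ne_zero)
      (by rw [hab]; exact one_ne_zero)
    have hs₁ : ∀ i ∈ s, (h₁ * (h * g)).1 *ᵥ a i = a i ∧ (h₁ * (h * g)).1 *ᵥ b i = b i := by
      intro i hi
      obtain ⟨p, q⟩ := hs i hi
      rw [mul_mulVec, mul_mulVec h₁, p, q]
      exact ⟨f₁ _ (mv _ _ _ p (haa i hi)) (haa i hi) (mv _ _ _ p (hba i hi)) (hba i hi),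
        f₁ _ (mv _ _ _ q (hab' i hi)) (hab' i hi) (mv _ _ _ q (hbb i hi)) (hbb i hi)⟩
    rw [← mul_mulVec] at e₁
    -- With `a k` in place, the image of `b k` still pairs to 1 with it and can be moved to `b k` by
    -- an element fixing `a k`.
    obtain ⟨h₂, hh₂, e₂, e₂', f₂⟩ := exists_mulVec_eq_of_fixed (u := a k)
      (x := (h₁ * (h * g)).1 *ᵥ b k) (y := b k)
      (by conv_lhs => rw [← e₁, sympForm_mulVec]
          exact hab) hab
    refine ⟨h₂ * (h₁ * h), mul_mem hh₂ (mul_mem hh₁ hh), ?_⟩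
    rw [show h₂ * (h₁ * h) * g = h₂ * (h₁ * (h * g)) by simp only [mul_assoc]]
    intro i hi
    rcases Finset.mem_insert.1 hi with rfl | hi
    · exact ⟨by rw [mul_mulVec h₂, e₁, e₂], by rw [mul_mulVec h₂, e₂']⟩
    · obtain ⟨p, q⟩ := hs₁ i hi
      rw [mul_mulVec h₂, mul_mulVec h₂, p, q]
      exact ⟨f₂ _ (haa i hi) (mv _ _ _ p (hba i hi)) (hba i hi),
        f₂ _ (hab' i hi) (mv _ _ _ q (hbb i hi)) (hbb i hi)⟩

/-- The symplectic group is generated by its transvections. -/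
theorem transvectionSubgroup_eq_top : transvectionSubgroup n K = ⊤ := by
  refine eq_top_iff.2 fun g _ => ?_
  obtain ⟨h, hh, H⟩ := exists_mul_fixes g Finset.univ
  have : h * g = 1 := by
    refine Subtype.ext (Matrix.ext_of_mulVec_single fun i => ?_)
    refine Eq.trans ?_ (one_mulVec _).symm
    rcases i with i | i
    · exact (H i (Finset.mem_univ i)).1
    · exact (H i (Finset.mem_univ i)).2
  rw [← inv_eq_of_mul_eq_one_right this]
  exact inv_mem hh

end Symplectic

/-! ### Schur's lemma and intertwiners of the Heisenberg representation -/

section Intertwiners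

variable {n : ℕ} {K F : Type*} [Field F]

theorem lhom_ext_eps {M : Type*} [AddCommMonoid M] [Module F M] {S T : SpaceY n K F →ₗ[F] M}
    (h : ∀ w : SpaceN n K, S (eps F w) = T (eps F w)) : S = T :=
  Finsupp.lhom_ext' fun w => LinearMap.ext_ring (h w)

theorem linearCombination_eps {M : Type*} [AddCommMonoid M] [Module F M] (f : SpaceN n K → M)
    (w : SpaceN n K) : Finsupp.linearCombination F f (eps F w) = f w := by
  rw [eps, Finsupp.linearCombination_single, one_smul]

theorem eps_ne_zero (w : SpaceN n K) : eps F w ≠ 0 :=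
  Finsupp.single_ne_zero.2 one_ne_zero

theorem eq_of_eps_apply_ne_zero {w v : SpaceN n K} (h : eps F v w ≠ 0) : w = v := by
  by_contra hne
  exact h (Finsupp.single_eq_of_ne hne)

/-- The linear operator on `Y` that multiplies each `ε_w` by `f w`. -/
def diagOp (f : SpaceN n K → F) : Module.End F (SpaceY n K F) :=
  Finsupp.linearCombination F fun w => f w • eps F w

theorem diagOp_eps (f : SpaceN n K → F) (w : SpaceN n K) :
    diagOp f (eps F w) = f w • eps F w :=
  linearCombination_eps _ w

theorem diagOp_apply (f : SpaceN n K → F) (y : SpaceY n K F) (w : SpaceN n K) :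
    diagOp f y w = f w * y w := by
  have : (Finsupp.lapply w).comp (diagOp f) = f w • Finsupp.lapply (R := F) w := by
    refine lhom_ext_eps fun w' => ?_
    rw [LinearMap.comp_apply, diagOp_eps]
    by_cases h : w' = w
    · subst h; simp
    · simp [eps, h]
  exact LinearMap.congr_fun this y

theorem diagOp_mul (f g : SpaceN n K → F) : diagOp f * diagOp g = diagOp (f * g) := by
  refine lhom_ext_eps fun w => ?_
  rw [Module.End.mul_apply, diagOp_eps, map_smul, diagOp_eps, diagOp_eps, smul_smul, mul_comm]
  rfl

theorem diagOp_one : diagOp (1 : SpaceN n K → F) = 1 :=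
  lhom_ext_eps fun w => by rw [diagOp_eps]; exact one_smul F _

variable [Field K] {ψ : AddChar K F}

theorem heisenbergOp_eps (α : K) (x : SpaceV n K) (w : SpaceN n K) :
    heisenbergOp ψ α x (eps F w) =
      ψ (α + (x ∘ Sum.inl) ⬝ᵥ (x ∘ Sum.inr + 2 • w)) • eps F (w + x ∘ Sum.inr) :=
  linearCombination_eps _ w

theorem heisenbergOp_eq_smul (α : K) (x : SpaceV n K) :
    heisenbergOp ψ α x = ψ α • heisenbergOp ψ 0 x := by
  refine lhom_ext_eps fun w => ?_
  rw [LinearMap.smul_apply, heisenbergOp_eps, heisenbergOp_eps, smul_smul, zero_add,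
    AddChar.map_add_eq_mul]

theorem heisenbergOp_zero_zero :
    heisenbergOp ψ 0 (0 : SpaceV n K) = (1 : Module.End F (SpaceY n K F)) := by
  refine lhom_ext_eps fun w => ?_
  rw [heisenbergOp_eps]
  have h1 : (0 : SpaceV n K) ∘ Sum.inl = (0 : SpaceN n K) := rfl
  have h2 : (0 : SpaceV n K) ∘ Sum.inr = (0 : SpaceN n K) := rfl
  simp [h1, h2]

theorem heisenbergOp_inr_eps (v w : SpaceN n K) :
    heisenbergOp ψ 0 (Sum.elim 0 v) (eps F w) = eps F (w + v) := by
  rw [heisenbergOp_eps, Sum.elim_comp_inl, Sum.elim_comp_inr, zero_dotProduct, add_zero,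
    AddChar.map_zero_eq_one, one_smul]

theorem heisenbergOp_inl_eps (u w : SpaceN n K) :
    heisenbergOp ψ 0 (Sum.elim u 0) (eps F w) = ψ (2 * (u ⬝ᵥ w)) • eps F w := by
  rw [heisenbergOp_eps, Sum.elim_comp_inl, Sum.elim_comp_inr, zero_add, zero_add, add_zero,
    dotProduct_smul, nsmul_eq_mul, Nat.cast_ofNat]

theorem exists_apply_mul_ne_one (hψ : ψ ≠ 1) {c : K} (hc : c ≠ 0) : ∃ s, ψ (c * s) ≠ 1 := by
  obtain ⟨s, hs⟩ := AddChar.ne_one_iff.1 hψ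
  exact ⟨c⁻¹ * s, by rwa [mul_inv_cancel_left₀ hc]⟩

/-- Schur's lemma for the representation `J`. -/
theorem exists_eq_smul_one_of_commute (h2 : (2 : K) ≠ 0) (hψ : ψ ≠ 1)
    {T : Module.End F (SpaceY n K F)}
    (hT : ∀ x : SpaceV n K, T * heisenbergOp ψ 0 x = heisenbergOp ψ 0 x * T) :
    ∃ c : F, T = c • 1 := by
  -- `T ε_0` is fixed by all `J(0, u)` with `u ∈ M`. These act on `ε_w` through the character `u ↦
  -- ψ(2⟨u, w⟩)`, which is non-trivial for `w ≠ 0`.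
  have h0 : T (eps F 0) = T (eps F 0) 0 • eps F 0 := by
    ext w
    by_cases hw : w = 0
    · subst hw; simp [eps]
    · obtain ⟨i, hi⟩ := Function.ne_iff.1 hw
      obtain ⟨s, hs⟩ := exists_apply_mul_ne_one hψ (mul_ne_zero h2 hi)
      have hd : heisenbergOp ψ 0 (Sum.elim (Pi.single i s) 0) =
          diagOp fun w : SpaceN n K => ψ (2 * (Pi.single i s ⬝ᵥ w)) :=
        lhom_ext_eps fun w => by rw [heisenbergOp_inl_eps, diagOp_eps]
      have h := DFunLike.congr_fun
        (LinearMap.congr_fun (hT (Sum.elim (Pi.single i s) 0)) (eps F 0)) w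
      rw [hd, Module.End.mul_apply, Module.End.mul_apply, diagOp_apply, diagOp_eps,
        dotProduct_zero, mul_zero, AddChar.map_zero_eq_one, one_smul, single_dotProduct] at h
      have h' : (ψ (2 * (s * w i)) - 1) * T (eps F 0) w = 0 := by rw [sub_mul, ← h]; ring
      rcases mul_eq_zero.1 h' with h' | h'
      · exact absurd (by rw [← sub_eq_zero.1 h']; congr 1; ring) hs
      · rw [h']; simp [eps, Ne.symm hw]
  refine ⟨T (eps F 0) 0, lhom_ext_eps fun w => ?_⟩
  -- Since `ε_w = J(0, w) ε_0`, the scalar found at `ε_0` serves for every `w`.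
  have h := LinearMap.congr_fun (hT (Sum.elim 0 w)) (eps F 0)
  rw [Module.End.mul_apply, Module.End.mul_apply, heisenbergOp_inr_eps, zero_add, h0, map_smul,
    heisenbergOp_inr_eps, zero_add] at h
  rw [h]; rfl

/-- The operator `ε_w ↦ ε_{-w}`. -/
def reflection (n : ℕ) (K F : Type*) [Field K] [Field F] : Module.End F (SpaceY n K F) :=
  Finsupp.linearCombination F fun w => eps F (-w)

theorem reflection_eps (w : SpaceN n K) : reflection n K F (eps F w) = eps F (-w) :=
  linearCombination_eps _ w

theorem reflection_apply (y : SpaceY n K F) (w : SpaceN n K) :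
    reflection n K F y w = y (-w) := by
  have : (Finsupp.lapply w).comp (reflection n K F) = Finsupp.lapply (R := F) (-w) := by
    refine lhom_ext_eps fun w' => ?_
    classical
    rw [LinearMap.comp_apply, reflection_eps, Finsupp.lapply_apply, Finsupp.lapply_apply, eps, eps,
      Finsupp.single_apply, Finsupp.single_apply]
    simp only [neg_eq_iff_eq_neg]
  exact LinearMap.congr_fun this y

theorem reflection_mul_heisenbergOp (α : K) (x : SpaceV n K) :
    reflection n K F * heisenbergOp ψ α x = heisenbergOp ψ α (-x) * reflection n K F := by
  refine lhom_ext_eps fun w => ?_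
  rw [Module.End.mul_apply, Module.End.mul_apply, heisenbergOp_eps, map_smul, reflection_eps,
    reflection_eps, heisenbergOp_eps]
  have h1 : (-x) ∘ Sum.inl = -(x ∘ Sum.inl) := rfl
  have h2 : (-x) ∘ Sum.inr = -(x ∘ Sum.inr) := rfl
  have h3 : -(x ∘ Sum.inr) + 2 • -w = -(x ∘ Sum.inr + 2 • w) := by module
  rw [h1, h2, h3, neg_dotProduct_neg, neg_add]

/-- An invertible operator `T` on `Y` that commutes with `ε_w ↦ ε_{-w}` and satisfies
`T J(α, x) T⁻¹ = J(α, g x)`. -/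
structure IsIntertwiner (ψ : AddChar K F) (g : symplecticGroup (Fin n) K)
    (T : Module.End F (SpaceY n K F)) : Prop where
  isUnit : IsUnit T
  commute : Commute T (reflection n K F)
  mul_heisenbergOp : ∀ (α : K) (x : SpaceV n K),
    T * heisenbergOp ψ α x = heisenbergOp ψ α (g.1 *ᵥ x) * T

theorem IsIntertwiner.one : IsIntertwiner ψ (1 : symplecticGroup (Fin n) K) 1 where
  isUnit := isUnit_one
  commute := Commute.one_left _
  mul_heisenbergOp α x := by rw [one_mul, mul_one]; exact congrArg _ (one_mulVec x).symm

theorem IsIntertwiner.mul {g h : symplecticGroup (Fin n) K} {S T : Module.End F (SpaceY n K F)}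
    (hS : IsIntertwiner ψ g S) (hT : IsIntertwiner ψ h T) : IsIntertwiner ψ (g * h) (S * T) where
  isUnit := hS.isUnit.mul hT.isUnit
  commute := hS.commute.mul_left hT.commute
  mul_heisenbergOp α x := by
    rw [mul_assoc, hT.mul_heisenbergOp, ← mul_assoc, hS.mul_heisenbergOp, mul_assoc, mul_mulVec]

theorem IsIntertwiner.exists_inv {g : symplecticGroup (Fin n) K}
    {T : Module.End F (SpaceY n K F)} (hT : IsIntertwiner ψ g T) :
    ∃ S, IsIntertwiner ψ g⁻¹ S := by
  obtain ⟨T, rfl⟩ := hT.isUnit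
  refine ⟨_, T⁻¹.isUnit, hT.commute.units_inv_left, fun α x => ?_⟩
  rw [Units.inv_mul_eq_iff_eq_mul, ← mul_assoc, hT.mul_heisenbergOp, mulVec_inv_mulVec,
    Units.mul_inv_cancel_right]

/-- The operator `∑_β ψ(c β²) J(0, β u)`. -/
def transvectionOp [Fintype K] (ψ : AddChar K F) (u : SpaceV n K) (c : K) :
    Module.End F (SpaceY n K F) :=
  ∑ β : K, ψ (c * β ^ 2) • heisenbergOp ψ 0 (β • u)

/-- Moving `J(a, x)` across the sum amounts to the substitution `β ↦ β - α⟨u, x⟩`. The central terms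
`±β⟨u, x⟩` that arise are absorbed by completing the square in `ψ(c β²)`, thanks to `c α = -1`. -/
theorem transvectionOp_mul_heisenbergOp [Fintype K] (u : SpaceV n K) {c α : K}
    (hc : c * α = -1) (a : K) (x : SpaceV n K) :
    transvectionOp ψ u c * heisenbergOp ψ a x =
      heisenbergOp ψ a ((transvection u α).1 *ᵥ x) * transvectionOp ψ u c := by
  rw [transvection_mulVec]
  set s := sympForm u x with hs
  simp only [transvectionOp, Finset.sum_mul, Finset.mul_sum, smul_mul_assoc, mul_smul_comm,
    heisenbergOp_mul]
  rw [← (Equiv.subRight (α * s)).sum_comp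
    (fun β : K => ψ (c * β ^ 2) • heisenbergOp ψ
      (a + 0 + sympForm (x + (α * s) • u) (β • u)) (x + (α * s) • u + β • u))]
  refine Finset.sum_congr rfl fun β _ => ?_
  rw [Equiv.subRight_apply, heisenbergOp_eq_smul,
    heisenbergOp_eq_smul (a + 0 + sympForm (x + (α * s) • u) _), smul_smul, smul_smul,
    ← AddChar.map_add_eq_mul, ← AddChar.map_add_eq_mul]
  have hx : sympForm x u = -s := sympForm_swap u x
  have hv : β • u + x = x + (α * s) • u + (β - α * s) • u := by module
  simp only [sympForm_smul_left, sympForm_smul_right, sympForm_add_left, sympForm_self, hx, ← hs]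
  rw [hv]
  congr 2
  linear_combination (2 * s * β - α * s ^ 2) * hc

theorem transvectionOp_commute_reflection [Fintype K] (u : SpaceV n K) (c : K) :
    Commute (transvectionOp ψ u c) (reflection n K F) := by
  symm
  change _ * _ = _ * _
  simp only [transvectionOp, Finset.sum_mul, Finset.mul_sum, smul_mul_assoc, mul_smul_comm,
    reflection_mul_heisenbergOp]
  refine Fintype.sum_equiv (Equiv.neg K) _ _ fun β => ?_
  rw [Equiv.neg_apply, neg_sq, neg_smul]

/-- The operators `J(0, βu)` multiply like the additive group. After `γ = δ - β` the terms in `β²`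
cancel, and the sum over `β` of `ψ(2cβδ)` vanishes unless `δ = 0`. -/
theorem transvectionOp_mul_neg [Fintype K] (h2 : (2 : K) ≠ 0) (hψ : ψ ≠ 1) (u : SpaceV n K)
    {c : K} (hc : c ≠ 0) :
    transvectionOp ψ u c * transvectionOp ψ u (-c) = (Fintype.card K : F) • 1 := by
  classical
  have h : ∀ β : K, ∑ γ : K, (ψ (c * β ^ 2) • heisenbergOp ψ 0 (β • u)) *
      (ψ (-c * γ ^ 2) • heisenbergOp ψ 0 (γ • u)) =
      ∑ δ : K, (ψ (-c * δ ^ 2) * ψ (β * (2 * c * δ))) • heisenbergOp ψ 0 (δ • u) := by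
    intro β
    refine (Fintype.sum_equiv (Equiv.subRight β) _ _ fun δ => ?_).symm
    rw [Equiv.subRight_apply, smul_mul_smul_comm, heisenbergOp_mul, sympForm_smul_left,
      sympForm_smul_right, sympForm_self, mul_zero, mul_zero, add_zero, add_zero, ← add_smul,
      add_sub_cancel, ← AddChar.map_add_eq_mul, ← AddChar.map_add_eq_mul]
    congr 2
    ring
  rw [transvectionOp, transvectionOp, Finset.sum_mul_sum, Finset.sum_congr rfl fun β _ => h β,
    Finset.sum_comm, Finset.sum_congr rfl fun δ _ => by
      rw [← Finset.sum_smul, ← Finset.mul_sum,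
        AddChar.sum_mulShift _ (AddChar.IsPrimitive.of_ne_one hψ)],
    Finset.sum_eq_single 0]
  · simp [heisenbergOp_zero_zero]
  · intro δ _ hδ
    rw [if_neg (mul_ne_zero (mul_ne_zero h2 hc) hδ), Nat.cast_zero, mul_zero, zero_smul]
  · exact fun h => absurd (Finset.mem_univ _) h

theorem isUnit_transvectionOp [Fintype K] (h2 : (2 : K) ≠ 0) (hq : (Fintype.card K : F) ≠ 0)
    (hψ : ψ ≠ 1) (u : SpaceV n K) {c : K} (hc : c ≠ 0) : IsUnit (transvectionOp ψ u c) := by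
  have h := transvectionOp_mul_neg h2 hψ u hc
  have h' := transvectionOp_mul_neg h2 hψ u (neg_ne_zero.2 hc)
  rw [neg_neg] at h'
  refine isUnit_iff_exists.2 ⟨(Fintype.card K : F)⁻¹ • transvectionOp ψ u (-c), ?_, ?_⟩
  · rw [mul_smul_comm, h, inv_smul_smul₀ hq]
  · rw [smul_mul_assoc, h', inv_smul_smul₀ hq]

theorem isIntertwiner_transvectionOp [Fintype K] (h2 : (2 : K) ≠ 0)
    (hq : (Fintype.card K : F) ≠ 0) (hψ : ψ ≠ 1) (u : SpaceV n K) {c α : K} (hc : c * α = -1) :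
    IsIntertwiner ψ (transvection u α) (transvectionOp ψ u c) where
  isUnit := isUnit_transvectionOp h2 hq hψ u (left_ne_zero_of_mul
    (hc.trans_ne (neg_ne_zero.2 one_ne_zero)))
  commute := transvectionOp_commute_reflection u c
  mul_heisenbergOp := transvectionOp_mul_heisenbergOp u hc

theorem exists_isIntertwiner [Fintype K] (h2 : (2 : K) ≠ 0) (hq : (Fintype.card K : F) ≠ 0)
    (hψ : ψ ≠ 1) (g : symplecticGroup (Fin n) K) : ∃ T, IsIntertwiner ψ g T := by
  have hg : g ∈ transvectionSubgroup n K := by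
    rw [transvectionSubgroup_eq_top]; exact Subgroup.mem_top g
  induction hg using Subgroup.closure_induction with
  | mem g hg =>
    obtain ⟨u, α, rfl⟩ := hg
    by_cases hα : α = 0
    · rw [hα, transvection_zero]
      exact ⟨1, .one⟩
    · have hc : -α⁻¹ * α = -1 := by rw [neg_mul, inv_mul_cancel₀ hα]
      exact ⟨_, isIntertwiner_transvectionOp h2 hq hψ u hc⟩
  | one => exact ⟨1, .one⟩
  | mul g h _ _ hg hh =>
    obtain ⟨S, hS⟩ := hg
    obtain ⟨T, hT⟩ := hh
    exact ⟨S * T, hS.mul hT⟩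
  | inv g _ hg =>
    obtain ⟨T, hT⟩ := hg
    exact hT.exists_inv

/-- Two operators that induce the same automorphism of the Heisenberg group are proportional. -/
theorem exists_eq_smul_of_mul_heisenbergOp (h2 : (2 : K) ≠ 0) (hψ : ψ ≠ 1)
    {g : symplecticGroup (Fin n) K} {S T : Module.End F (SpaceY n K F)} (hS : IsUnit S)
    (hS' : ∀ x : SpaceV n K, S * heisenbergOp ψ 0 x = heisenbergOp ψ 0 (g.1 *ᵥ x) * S)
    (hT : IsUnit T)
    (hT' : ∀ x : SpaceV n K, T * heisenbergOp ψ 0 x = heisenbergOp ψ 0 (g.1 *ᵥ x) * T) :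
    ∃ c : F, c ≠ 0 ∧ T = c • S := by
  obtain ⟨S, rfl⟩ := hS
  obtain ⟨c, hc⟩ := exists_eq_smul_one_of_commute h2 hψ (T := (S⁻¹).1 * T) fun x : SpaceV n K => by
    rw [mul_assoc, hT', Units.inv_mul_eq_iff_eq_mul, ← mul_assoc, ← mul_assoc, hS',
      Units.mul_inv_cancel_right]
  rw [Units.inv_mul_eq_iff_eq_mul, mul_smul_comm, mul_one] at hc
  refine ⟨c, ?_, hc⟩
  rintro rfl
  rw [hc, zero_smul, isUnit_zero_iff] at hT
  exact eps_ne_zero (0 : SpaceN n K) (LinearMap.congr_fun hT (eps F 0)).symm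

/-- The basis vector `uₙ`, as an element of `V`. -/
def uLast (n : ℕ) [NeZero n] (K : Type*) [Field K] : SpaceV n K := Sum.elim (vLast n K) 0

/-- A diagonal intertwiner, for which the normalising determinants can be read off. The factor `ψ(α
wₙ²)` accounts for the multiple of `uₙ` that the transvection adds to `x`. -/
theorem isIntertwiner_diagOp [NeZero n] (α : K) :
    IsIntertwiner ψ (transvection (uLast n K) α)
      (diagOp fun w : SpaceN n K => ψ (α * w ⊤ ^ 2)) where
  isUnit := by
    have h : ∀ a : K, diagOp (F := F) (fun w : SpaceN n K => ψ (a * w ⊤ ^ 2)) *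
        diagOp (fun w : SpaceN n K => ψ (-a * w ⊤ ^ 2)) = 1 := fun a => by
      rw [diagOp_mul, ← diagOp_one]
      congr 1
      funext w
      rw [Pi.mul_apply, ← AddChar.map_add_eq_mul, ← add_mul, add_neg_cancel, zero_mul,
        AddChar.map_zero_eq_one, Pi.one_apply]
    exact isUnit_iff_exists.2 ⟨_, h α, by simpa only [neg_neg] using h (-α)⟩
  commute := by
    refine lhom_ext_eps fun w => ?_
    rw [Module.End.mul_apply, Module.End.mul_apply, diagOp_eps, map_smul, reflection_eps,
      diagOp_eps, Pi.neg_apply, neg_sq]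
  mul_heisenbergOp a x := by
    have hs : sympForm (uLast n K) x = x (Sum.inr ⊤) := by
      simp [sympForm, uLast, vLast, Pi.single_apply]
    have hl : (x + (α * x (Sum.inr ⊤)) • uLast n K) ∘ Sum.inl =
      x ∘ Sum.inl + (α * x (Sum.inr ⊤)) • vLast n K := rfl
    have hr : (x + (α * x (Sum.inr ⊤)) • uLast n K) ∘ Sum.inr = x ∘ Sum.inr := by
      funext i; simp [uLast]
    refine lhom_ext_eps fun w => ?_
    rw [Module.End.mul_apply, Module.End.mul_apply, diagOp_eps, map_smul, transvection_mulVec, hs,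
      heisenbergOp_eps, heisenbergOp_eps, hl, hr, map_smul, diagOp_eps, smul_smul, smul_smul,
      ← AddChar.map_add_eq_mul, ← AddChar.map_add_eq_mul, add_dotProduct, smul_dotProduct,
      vLast, single_dotProduct]
    congr 2
    simp only [Pi.add_apply, Function.comp_apply, smul_eq_mul, two_nsmul]
    ring

variable [NeZero n]

theorem vLast_ne_zero : vLast n K ≠ 0 := by
  rw [vLast, Ne, Pi.single_eq_zero_iff]
  exact one_ne_zero

theorem heisenbergOp_smul_uLast_eps_zero (β : K) :
    heisenbergOp ψ 0 (β • uLast n K) (eps F 0) = eps F 0 := by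
  have : β • uLast n K = Sum.elim (β • vLast n K) 0 := by
    funext i; rcases i with i | i <;> simp [uLast]
  rw [this, heisenbergOp_inl_eps, dotProduct_zero, mul_zero, AddChar.map_zero_eq_one, one_smul]

theorem exists_mulVec_uLast :
    ∃ g : symplecticGroup (Fin n) K, g.1 *ᵥ uLast n K = (Sum.elim 0 (vLast n K) : SpaceV n K) := by
  refine exists_symplectic_mulVec_eq (fun h => vLast_ne_zero (n := n) (K := K) ?_)
    fun h => vLast_ne_zero (n := n) (K := K) ?_
  · exact funext fun i => congrFun h (Sum.inl i)
  · exact funext fun i => congrFun h (Sum.inr i)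

theorem heisenbergOp_smul_vLast_eps (β : K) (w : SpaceN n K) :
    heisenbergOp ψ 0 (β • (Sum.elim 0 (vLast n K) : SpaceV n K)) (eps F w) =
      eps F (w + β • vLast n K) := by
  have : β • (Sum.elim 0 (vLast n K) : SpaceV n K) =
      (Sum.elim 0 (β • vLast n K) : SpaceV n K) := by
    funext i; rcases i with i | i <;> simp
  rw [this, heisenbergOp_inr_eps]

end Intertwiners

/-! ### The subspaces of even and odd vectors and their dimensions -/

section EigenspacesOfReflection

variable {n : ℕ} {K F : Type*} [Field F]

theorem range_le_of_eps {T : Module.End F (SpaceY n K F)} {W : Submodule F (SpaceY n K F)}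
    (h : ∀ w : SpaceN n K, T (eps F w) ∈ W) : LinearMap.range T ≤ W := by
  rintro _ ⟨y, rfl⟩
  induction y using Finsupp.induction_linear with
  | zero => rw [map_zero]; exact W.zero_mem
  | add x y hx hy => rw [map_add]; exact W.add_mem hx hy
  | single w c =>
    have : Finsupp.single w c = c • eps F w := by
      rw [eps, Finsupp.smul_single, smul_eq_mul, mul_one]
    rw [this, map_smul]
    exact W.smul_mem _ (h w)

/-- The restriction of the coordinate functions to a finite set. -/
def restrictCoords (s : Finset (SpaceN n K)) : SpaceY n K F →ₗ[F] (s → F) :=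
  LinearMap.pi fun w => Finsupp.lapply w.1

theorem restrictCoords_eps {s : Finset (SpaceN n K)} [DecidableEq s] (w : s) :
    restrictCoords s (eps F w.1) = Pi.single w 1 := by
  classical
  funext w'
  change eps F w.1 w'.1 = _
  rw [eps, Finsupp.single_apply, Pi.single_apply]
  exact if_congr (Subtype.ext_iff.symm.trans eq_comm) rfl rfl

theorem restrictCoords_eps_of_notMem {s : Finset (SpaceN n K)} {w : SpaceN n K} (hw : w ∉ s) :
    restrictCoords s (eps F w) = 0 := by
  funext w'
  exact Finsupp.single_eq_of_ne fun e => hw (e ▸ w'.2)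

theorem linearIndependent_of_restrictCoords {s : Finset (SpaceN n K)} [DecidableEq s]
    {v : s → SpaceY n K F} (h : ∀ w, restrictCoords s (v w) = Pi.single w 1) :
    LinearIndependent F v := by
  refine LinearIndependent.of_comp (restrictCoords s) ?_
  have : restrictCoords s ∘ v = fun w => Pi.single w (1 : F) := funext h
  rw [this]
  exact Pi.linearIndependent_single_one s F

variable [Field K]

/-- `F` may have characteristic 2, where the eigenvalues 1 and -1 coincide. The image and the kernel
of `1 - reflection` describe `Y⁻` and `Y⁺ ⊕ Y₀` in every characteristic, and both are preserved by
any operator commuting with the reflection. -/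
theorem yMinus_eq_range : yMinus n K F = LinearMap.range (1 - reflection n K F) := by
  refine le_antisymm (Submodule.span_le.2 ?_) (range_le_of_eps fun w => ?_)
  · rintro _ ⟨w, -, rfl⟩
    exact ⟨eps F w, by rw [LinearMap.sub_apply, reflection_eps]; rfl⟩
  · rw [LinearMap.sub_apply, reflection_eps, Module.End.one_apply]
    by_cases hw : w = 0
    · rw [hw, neg_zero, sub_self]; exact Submodule.zero_mem _
    · exact Submodule.subset_span ⟨w, hw, rfl⟩

theorem yPlus_sup_yZero_le_ker :
    yPlus n K F ⊔ yZero n K F ≤ LinearMap.ker (1 - reflection n K F) := by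
  refine sup_le (Submodule.span_le.2 ?_) (Submodule.span_le.2 ?_)
  · rintro _ ⟨w, -, rfl⟩
    rw [SetLike.mem_coe, LinearMap.mem_ker, LinearMap.sub_apply, map_add (reflection n K F),
      reflection_eps, reflection_eps, neg_neg, Module.End.one_apply, add_comm, sub_self]
  · rintro _ rfl
    rw [SetLike.mem_coe, LinearMap.mem_ker, LinearMap.sub_apply, reflection_eps, neg_zero,
      Module.End.one_apply, sub_self]

theorem commute_one_sub {T : Module.End F (SpaceY n K F)} (hT : Commute T (reflection n K F))
    (y : SpaceY n K F) :
    T ((1 - reflection n K F) y) = (1 - reflection n K F) (T y) := by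
  rw [LinearMap.sub_apply, LinearMap.sub_apply, map_sub]
  exact congrArg _ (LinearMap.congr_fun hT.eq y)

theorem apply_mem_yMinus {T : Module.End F (SpaceY n K F)}
    (hT : Commute T (reflection n K F)) : ∀ y ∈ yMinus n K F, T y ∈ yMinus n K F := by
  rw [yMinus_eq_range]
  rintro _ ⟨y, rfl⟩
  exact ⟨T y, (commute_one_sub hT y).symm⟩

theorem neg_ne_self (h2 : (2 : K) ≠ 0) {w : SpaceN n K} (hw : w ≠ 0) : -w ≠ w := by
  obtain ⟨i, hi⟩ := Function.ne_iff.1 hw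
  intro h
  refine mul_ne_zero h2 hi ?_
  have := congrFun h i
  rw [Pi.neg_apply] at this
  linear_combination -this

variable [Fintype K]

/-- A set of representatives of the pairs `{w, -w}` with `w ≠ 0`. -/
def halfSpace (n : ℕ) (K : Type*) [Field K] [Fintype K] : Finset (SpaceN n K) :=
  open Classical in
  Finset.univ.filter fun w => Fintype.equivFin (SpaceN n K) w < Fintype.equivFin (SpaceN n K) (-w)

theorem zero_notMem_halfSpace : (0 : SpaceN n K) ∉ halfSpace n K := by
  simp [halfSpace]

theorem neg_notMem_halfSpace {w : SpaceN n K} (hw : w ∈ halfSpace n K) : -w ∉ halfSpace n K := by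
  simp only [halfSpace, Finset.mem_filter, Finset.mem_univ, true_and, neg_neg] at hw ⊢
  exact lt_asymm hw

theorem neg_mem_halfSpace (h2 : (2 : K) ≠ 0) {w : SpaceN n K} (hw : w ≠ 0)
    (h : w ∉ halfSpace n K) : -w ∈ halfSpace n K := by
  simp only [halfSpace, Finset.mem_filter, Finset.mem_univ, true_and, neg_neg, not_lt] at h ⊢
  exact lt_of_le_of_ne h fun e => neg_ne_self h2 hw ((Fintype.equivFin _).injective e)

theorem two_mul_card_halfSpace (h2 : (2 : K) ≠ 0) :
    2 * (halfSpace n K).card + 1 = Fintype.card K ^ n := by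
  classical
  have hd : Disjoint (halfSpace n K) ((halfSpace n K).image Neg.neg) := by
    rw [Finset.disjoint_left]
    rintro w hw hw'
    obtain ⟨v, hv, rfl⟩ := Finset.mem_image.1 hw'
    exact neg_notMem_halfSpace hv hw
  have h0 : (0 : SpaceN n K) ∉ halfSpace n K ∪ (halfSpace n K).image Neg.neg := by
    simp [zero_notMem_halfSpace]
  have hu : insert 0 (halfSpace n K ∪ (halfSpace n K).image Neg.neg) = Finset.univ := by
    refine Finset.eq_univ_iff_forall.2 fun w => ?_
    simp only [Finset.mem_insert, Finset.mem_union, Finset.mem_image]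
    by_cases hw : w = 0
    · exact Or.inl hw
    · by_cases h : w ∈ halfSpace n K
      · exact Or.inr (Or.inl h)
      · exact Or.inr (Or.inr ⟨-w, neg_mem_halfSpace h2 hw h, neg_neg w⟩)
  have := congrArg Finset.card hu
  rw [Finset.card_insert_of_notMem h0, Finset.card_union_of_disjoint hd,
    Finset.card_image_of_injective _ neg_injective, Finset.card_univ, Fintype.card_fun,
    Fintype.card_fin] at this
  rw [← this]; ring

/-- The basis vectors of `Y⁻`. -/
def minusVec (w : halfSpace n K) : SpaceY n K F := eps F w.1 - eps F (-w.1)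

theorem linearIndependent_minusVec :
    LinearIndependent F (minusVec : halfSpace n K → SpaceY n K F) := by
  classical
  refine linearIndependent_of_restrictCoords fun w => ?_
  rw [minusVec, map_sub, restrictCoords_eps,
    restrictCoords_eps_of_notMem (neg_notMem_halfSpace w.2), sub_zero]

theorem yMinus_eq_span (h2 : (2 : K) ≠ 0) :
    yMinus n K F = Submodule.span F (Set.range (minusVec : halfSpace n K → SpaceY n K F)) := by
  refine le_antisymm (Submodule.span_le.2 ?_) (Submodule.span_le.2 ?_)
  · rintro _ ⟨w, hw, rfl⟩
    by_cases h : w ∈ halfSpace n K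
    · exact Submodule.subset_span ⟨⟨w, h⟩, rfl⟩
    · rw [← neg_sub]
      refine Submodule.neg_mem _ (Submodule.subset_span ⟨⟨-w, neg_mem_halfSpace h2 hw h⟩, ?_⟩)
      rw [minusVec, neg_neg]
  · rintro _ ⟨w, rfl⟩
    exact Submodule.subset_span ⟨w.1, fun e => zero_notMem_halfSpace (e ▸ w.2), rfl⟩

theorem finrank_yMinus (h2 : (2 : K) ≠ 0) :
    Module.finrank F (yMinus n K F) = (halfSpace n K).card := by
  rw [yMinus_eq_span h2, finrank_span_eq_card linearIndependent_minusVec, Fintype.card_coe]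

/-- A set of representatives of the pairs `{w, -w}`. -/
def halfSpaceZero (n : ℕ) (K : Type*) [Field K] [Fintype K] : Finset (SpaceN n K) :=
  open Classical in insert 0 (halfSpace n K)

theorem mem_halfSpaceZero {w : SpaceN n K} :
    w ∈ halfSpaceZero n K ↔ w = 0 ∨ w ∈ halfSpace n K := by
  classical exact Finset.mem_insert

/-- The basis vectors of `Y⁺ ⊕ Y₀`. -/
def plusVec (w : halfSpaceZero n K) : SpaceY n K F :=
  open Classical in if w.1 = 0 then eps F 0 else eps F w.1 + eps F (-w.1)

/-- The separate value of `plusVec` at 0 gives the coordinate 1 there; the sum `ε_0 + ε_{-0}` would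
give 2, which can vanish in `F`. -/
theorem restrictCoords_plusVec [DecidableEq (halfSpaceZero n K)] (w : halfSpaceZero n K) :
    restrictCoords _ (plusVec w : SpaceY n K F) = Pi.single w 1 := by
  classical
  by_cases hw : w.1 = 0
  · rw [plusVec, if_pos hw, ← hw, restrictCoords_eps]
  · have hm := (mem_halfSpaceZero.1 w.2).resolve_left hw
    have h : -w.1 ∉ halfSpaceZero n K := by
      rw [mem_halfSpaceZero, not_or, neg_eq_zero]
      exact ⟨hw, neg_notMem_halfSpace hm⟩
    rw [plusVec, if_neg hw, map_add, restrictCoords_eps, restrictCoords_eps_of_notMem h, add_zero]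

theorem linearIndependent_plusVec :
    LinearIndependent F (plusVec : halfSpaceZero n K → SpaceY n K F) := by
  classical exact linearIndependent_of_restrictCoords restrictCoords_plusVec

theorem plusVec_mem (w : halfSpaceZero n K) : plusVec w ∈ yPlus n K F ⊔ yZero n K F := by
  unfold plusVec
  split_ifs with h
  · exact Submodule.mem_sup_right (Submodule.subset_span rfl)
  · exact Submodule.mem_sup_left (Submodule.subset_span ⟨_, h, rfl⟩)

theorem ker_le_span_plusVec (h2 : (2 : K) ≠ 0) :
    LinearMap.ker (1 - reflection n K F) ≤
      Submodule.span F (Set.range (plusVec : halfSpaceZero n K → SpaceY n K F)) := by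
  classical
  intro y hy
  -- An even vector is determined by its coordinates on representatives of the pairs `{w, -w}`, and
  -- there `z` agrees with `y`.
  set z : SpaceY n K F := ∑ w : halfSpaceZero n K, y w.1 • plusVec w with hz
  have hzk : z ∈ LinearMap.ker (1 - reflection n K F) := by
    rw [hz]
    exact Submodule.sum_mem _ fun w _ =>
      Submodule.smul_mem _ _ (yPlus_sup_yZero_le_ker (plusVec_mem w))
  have hyz : y = z := by
    have hr : restrictCoords (halfSpaceZero n K) (y - z) = 0 := by
      rw [map_sub, hz, map_sum]
      simp only [map_smul, restrictCoords_plusVec]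
      rw [sub_eq_zero]
      funext w
      simp [Finset.sum_apply, Pi.single_apply, restrictCoords]
    have hk := sub_mem hy hzk
    rw [← sub_eq_zero]
    ext w
    by_cases h : w ∈ halfSpaceZero n K
    · exact congrFun hr ⟨w, h⟩
    · rw [mem_halfSpaceZero, not_or] at h
      have hw := neg_mem_halfSpace h2 h.1 h.2
      rw [LinearMap.mem_ker, LinearMap.sub_apply, Module.End.one_apply, sub_eq_zero] at hk
      rw [hk, reflection_apply]
      exact congrFun hr ⟨-w, mem_halfSpaceZero.2 (Or.inr hw)⟩
  rw [hyz]
  exact Submodule.sum_mem _ fun w _ => Submodule.smul_mem _ _ (Submodule.subset_span ⟨w, rfl⟩)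

theorem span_plusVec_le :
    Submodule.span F (Set.range (plusVec : halfSpaceZero n K → SpaceY n K F)) ≤
      yPlus n K F ⊔ yZero n K F := by
  rw [Submodule.span_le]
  rintro _ ⟨w, rfl⟩
  exact plusVec_mem w

theorem yPlus_sup_yZero_eq_span (h2 : (2 : K) ≠ 0) : yPlus n K F ⊔ yZero n K F =
    Submodule.span F (Set.range (plusVec : halfSpaceZero n K → SpaceY n K F)) :=
  le_antisymm (yPlus_sup_yZero_le_ker.trans (ker_le_span_plusVec h2)) span_plusVec_le

theorem yPlus_sup_yZero_eq_ker (h2 : (2 : K) ≠ 0) :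
    yPlus n K F ⊔ yZero n K F = LinearMap.ker (1 - reflection n K F) :=
  le_antisymm yPlus_sup_yZero_le_ker ((ker_le_span_plusVec h2).trans span_plusVec_le)

theorem finrank_yPlus_sup_yZero (h2 : (2 : K) ≠ 0) :
    Module.finrank F ↥(yPlus n K F ⊔ yZero n K F) = (halfSpace n K).card + 1 := by
  classical
  rw [yPlus_sup_yZero_eq_span h2, finrank_span_eq_card linearIndependent_plusVec,
    Fintype.card_coe, halfSpaceZero, Finset.card_insert_of_notMem zero_notMem_halfSpace]

theorem apply_mem_yPlus_sup_yZero (h2 : (2 : K) ≠ 0) {T : Module.End F (SpaceY n K F)}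
    (hT : Commute T (reflection n K F)) :
    ∀ y ∈ yPlus n K F ⊔ yZero n K F, T y ∈ yPlus n K F ⊔ yZero n K F := by
  rw [yPlus_sup_yZero_eq_ker h2]
  intro y hy
  rw [LinearMap.mem_ker, ← commute_one_sub hT, LinearMap.mem_ker.1 hy, map_zero]

end EigenspacesOfReflection

/-! ### Determinants on invariant subspaces -/

section DetOn

variable {F M : Type*} [Field F] [AddCommGroup M] [Module F M]

/-- The determinant of the restriction of `T` to the subspace `W`, if this subspace is
invariant. -/
def detOn (W : Submodule F M) (T : Module.End F M) : F :=
  open Classical in if h : ∀ y ∈ W, T y ∈ W then LinearMap.det (T.restrict h) else 0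

theorem detOn_eq {W : Submodule F M} {T : Module.End F M} (h : ∀ y ∈ W, T y ∈ W) :
    detOn W T = LinearMap.det (T.restrict h) :=
  dif_pos h

theorem detOn_one (W : Submodule F M) : detOn W 1 = 1 := by
  rw [detOn_eq fun y hy => hy]
  exact LinearMap.det_id

theorem detOn_mul {W : Submodule F M} {S T : Module.End F M} (hS : ∀ y ∈ W, S y ∈ W)
    (hT : ∀ y ∈ W, T y ∈ W) : detOn W (S * T) = detOn W S * detOn W T := by
  rw [detOn_eq (T := S * T) fun y hy => hS _ (hT y hy), detOn_eq hS, detOn_eq hT, ← map_mul]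
  rfl

theorem detOn_smul {W : Submodule F M} {T : Module.End F M} (hT : ∀ y ∈ W, T y ∈ W) (c : F) :
    detOn W (c • T) = c ^ Module.finrank F W * detOn W T := by
  rw [detOn_eq fun y hy => W.smul_mem c (hT y hy), detOn_eq hT, ← LinearMap.det_smul]
  rfl

theorem detOn_eq_prod {ι : Type*} [Fintype ι] {v : ι → M} (hv : LinearIndependent F v)
    {W : Submodule F M} (hW : W = Submodule.span F (Set.range v)) {T : Module.End F M} {d : ι → F}
    (hd : ∀ i, T (v i) = d i • v i) : detOn W T = ∏ i, d i := by
  classical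
  have hT : ∀ y ∈ W, T y ∈ W := by
    subst hW
    change Submodule.span F (Set.range v) ≤ Submodule.comap T (Submodule.span F (Set.range v))
    rw [Submodule.span_le]
    rintro _ ⟨i, rfl⟩
    rw [SetLike.mem_coe, Submodule.mem_comap, hd]
    exact Submodule.smul_mem _ _ (Submodule.subset_span ⟨i, rfl⟩)
  rw [detOn_eq hT]
  subst hW
  have hm : LinearMap.toMatrix (Module.Basis.span hv) (Module.Basis.span hv) (T.restrict hT) =
      Matrix.diagonal d := by
    ext i j
    have : T.restrict hT (Module.Basis.span hv j) = d j • Module.Basis.span hv j := by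
      refine Subtype.ext ?_
      rw [LinearMap.coe_restrict_apply, Submodule.coe_smul, Module.Basis.span_apply, hd]
    rw [LinearMap.toMatrix_apply, this, map_smul, Module.Basis.repr_self, Finsupp.smul_single,
      Matrix.diagonal_apply, Finsupp.single_apply]
    by_cases h : j = i
    · subst h; simp
    · simp [h, Ne.symm h]
  rw [← LinearMap.det_toMatrix (Module.Basis.span hv), hm, Matrix.det_diagonal]

end DetOn

/-! ### Existence and uniqueness of the Weil representation -/

section WeilRepresentation

variable {n : ℕ} {K F : Type*} [Field K] [Field F] {ψ : AddChar K F}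

/-- The multiple of the operator `T` that does not change if `T` is multiplied by a scalar. -/
def normalizedOp (T : Module.End F (SpaceY n K F)) : Module.End F (SpaceY n K F) :=
  (detOn (yMinus n K F) T / detOn (yPlus n K F ⊔ yZero n K F) T) • T

theorem normalizedOp_one : normalizedOp (1 : Module.End F (SpaceY n K F)) = 1 := by
  rw [normalizedOp, detOn_one, detOn_one, div_one, one_smul]

theorem ringChar_ne_two (h2 : (2 : K) ≠ 0) : ringChar K ≠ 2 := fun h => by
  have h' := ringChar.Nat.cast_ringChar (R := K)
  rw [h] at h'
  exact h2 (by exact_mod_cast h')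

variable [Fintype K]

/-- Needed to write `ρ_{u,α}` as a product of two transvections with coefficient `-1`, along
multiples of `u`. -/
theorem exists_sq_add_sq_eq (h2 : (2 : K) ≠ 0) (x : K) : ∃ a b : K, a ^ 2 + b ^ 2 = x := by
  obtain ⟨a, b, hab⟩ := FiniteField.exists_root_sum_quadratic (R := K)
    (Polynomial.degree_X_pow 2) (Polynomial.degree_X_pow_sub_C (n := 2) (by decide) x)
    (FiniteField.odd_card_of_char_ne_two ((ringChar_ne_two h2)))
  refine ⟨a, b, ?_⟩
  rw [← sub_eq_zero]
  simpa only [Polynomial.eval_C, Polynomial.eval_X, Polynomial.eval_pow, Polynomial.eval_sub,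
    ← add_sub_assoc] using hab

theorem normalizedOp_mul (h2 : (2 : K) ≠ 0) {S T : Module.End F (SpaceY n K F)}
    (hS : Commute S (reflection n K F)) (hT : Commute T (reflection n K F)) :
    normalizedOp (S * T) = normalizedOp S * normalizedOp T := by
  rw [normalizedOp, detOn_mul (apply_mem_yMinus hS) (apply_mem_yMinus hT),
    detOn_mul (apply_mem_yPlus_sup_yZero h2 hS) (apply_mem_yPlus_sup_yZero h2 hT), normalizedOp,
    normalizedOp, smul_mul_smul_comm, mul_div_mul_comm]

/-- The dimensions `m` and `m + 1` differ by one, so the quotient of determinants changes by `c ^ m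
/ c ^ (m + 1) = c⁻¹`, which cancels the factor `c` of the operator. -/
theorem normalizedOp_smul (h2 : (2 : K) ≠ 0) {T : Module.End F (SpaceY n K F)}
    (hT : Commute T (reflection n K F)) {c : F} (hc : c ≠ 0) :
    normalizedOp (c • T) = normalizedOp T := by
  rw [normalizedOp, detOn_smul (apply_mem_yMinus hT),
    detOn_smul (apply_mem_yPlus_sup_yZero h2 hT), finrank_yMinus h2, finrank_yPlus_sup_yZero h2,
    normalizedOp, smul_smul, pow_succ, mul_assoc, mul_div_mul_left _ _ (pow_ne_zero _ hc),
    mul_comm c, ← mul_div_right_comm, mul_div_mul_right _ _ hc]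

/-- The two determinants are products of `f` over the representatives without and with 0, so their
quotient is `(f 0)⁻¹`. -/
theorem normalizedOp_diagOp (h2 : (2 : K) ≠ 0) {f : SpaceN n K → F} (hf : ∀ w, f (-w) = f w)
    (hf0 : ∀ w, f w ≠ 0) : normalizedOp (diagOp f) = (f 0)⁻¹ • diagOp f := by
  classical
  have hm : detOn (yMinus n K F) (diagOp f) = ∏ w ∈ halfSpace n K, f w := by
    have hv := linearIndependent_minusVec (n := n) (K := K) (F := F)
    have hW := yMinus_eq_span (n := n) (F := F) h2
    refine (detOn_eq_prod (M := SpaceY n K F) (d := fun w => f w.1) hv hW fun w => ?_).trans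
      (Finset.prod_coe_sort _ _)
    rw [minusVec, map_sub, diagOp_eps, diagOp_eps, hf, smul_sub]
  have hp : detOn (yPlus n K F ⊔ yZero n K F) (diagOp f) = ∏ w ∈ halfSpaceZero n K, f w := by
    have hv := linearIndependent_plusVec (n := n) (K := K) (F := F)
    have hW := yPlus_sup_yZero_eq_span (n := n) (F := F) h2
    refine (detOn_eq_prod (M := SpaceY n K F) (d := fun w => f w.1) hv hW fun w => ?_).trans
      (Finset.prod_coe_sort _ _)
    by_cases hw : w.1 = 0
    · rw [plusVec, if_pos hw, diagOp_eps, hw]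
    · rw [plusVec, if_neg hw, map_add, diagOp_eps, diagOp_eps, hf, smul_add]
  rw [normalizedOp, hm, hp, halfSpaceZero, Finset.prod_insert zero_notMem_halfSpace,
    div_mul_cancel_right₀ (Finset.prod_ne_zero_iff.2 fun w _ => hf0 w)]

theorem IsIntertwiner.normalizedOp_eq (h2 : (2 : K) ≠ 0) (hψ : ψ ≠ 1)
    {g : symplecticGroup (Fin n) K} {S T : Module.End F (SpaceY n K F)}
    (hS : IsIntertwiner ψ g S) (hT : IsIntertwiner ψ g T) : normalizedOp S = normalizedOp T := by
  obtain ⟨c, hc, rfl⟩ := exists_eq_smul_of_mul_heisenbergOp h2 hψ hS.isUnit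
    (hS.mul_heisenbergOp 0) hT.isUnit (hT.mul_heisenbergOp 0)
  rw [normalizedOp_smul h2 hS.commute hc]

/-- The Weil representation of type `ψ`. -/
def weilRep (h2 : (2 : K) ≠ 0) (hq : (Fintype.card K : F) ≠ 0) (hψ : ψ ≠ 1) :
    Representation F (symplecticGroup (Fin n) K) (SpaceY n K F) where
  toFun g := normalizedOp (exists_isIntertwiner h2 hq hψ g).choose
  map_one' := by
    rw [(exists_isIntertwiner h2 hq hψ 1).choose_spec.normalizedOp_eq h2 hψ .one, normalizedOp_one]
  map_mul' g h := by
    have hg := (exists_isIntertwiner h2 hq hψ g).choose_spec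
    have hh := (exists_isIntertwiner h2 hq hψ h).choose_spec
    rw [← normalizedOp_mul h2 hg.commute hh.commute]
    exact (exists_isIntertwiner h2 hq hψ (g * h)).choose_spec.normalizedOp_eq h2 hψ (hg.mul hh)

theorem weilRep_eq (h2 : (2 : K) ≠ 0) (hq : (Fintype.card K : F) ≠ 0) (hψ : ψ ≠ 1)
    {g : symplecticGroup (Fin n) K} {T : Module.End F (SpaceY n K F)} (hT : IsIntertwiner ψ g T) :
    weilRep h2 hq hψ g = normalizedOp T :=
  (exists_isIntertwiner h2 hq hψ g).choose_spec.normalizedOp_eq h2 hψ hT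

theorem weilRep_commute_reflection (h2 : (2 : K) ≠ 0) (hq : (Fintype.card K : F) ≠ 0)
    (hψ : ψ ≠ 1) (g : symplecticGroup (Fin n) K) :
    Commute (weilRep h2 hq hψ g) (reflection n K F) :=
  (exists_isIntertwiner h2 hq hψ g).choose_spec.commute.smul_left _

theorem weilRep_mul_heisenbergOp (h2 : (2 : K) ≠ 0) (hq : (Fintype.card K : F) ≠ 0)
    (hψ : ψ ≠ 1) (g : symplecticGroup (Fin n) K) (α : K) (x : SpaceV n K) :
    weilRep h2 hq hψ g * heisenbergOp ψ α x =
      heisenbergOp ψ α (g.1 *ᵥ x) * weilRep h2 hq hψ g := by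
  obtain ⟨T, hT⟩ := exists_isIntertwiner h2 hq hψ g
  rw [weilRep_eq h2 hq hψ hT, normalizedOp, smul_mul_assoc, hT.mul_heisenbergOp, mul_smul_comm]

variable [NeZero n]

theorem weilRep_transvection_uLast (h2 : (2 : K) ≠ 0) (hq : (Fintype.card K : F) ≠ 0)
    (hψ : ψ ≠ 1) (α : K) : weilRep h2 hq hψ (transvection (uLast n K) α) =
      diagOp fun w : SpaceN n K => ψ (α * w ⊤ ^ 2) := by
  rw [weilRep_eq h2 hq hψ (isIntertwiner_diagOp α), normalizedOp_diagOp h2]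
  · rw [Pi.zero_apply, zero_pow two_ne_zero, mul_zero, AddChar.map_zero_eq_one, inv_one, one_smul]
  · intro w
    rw [Pi.neg_apply, neg_sq]
  · exact fun w => (AddChar.val_isUnit ψ _).ne_zero

/-- No determinant of `transvectionOp` is computed. If `g uₙ = vₙ`, the vector `P(g) ε_0` is fixed
by the Weil operator, while `transvectionOp` multiplies it by the Gauss sum; this gives the scalar
and shows that the Gauss sum is nonzero. -/
theorem weilRep_transvection_vLast (h2 : (2 : K) ≠ 0) (hq : (Fintype.card K : F) ≠ 0)
    (hψ : ψ ≠ 1) : weilRep h2 hq hψ (transvection (Sum.elim 0 (vLast n K)) (-1)) =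
      (∑ β : K, ψ (β ^ 2))⁻¹ • transvectionOp ψ (Sum.elim 0 (vLast n K)) 1 := by
  rw [weilRep_eq h2 hq hψ (isIntertwiner_transvectionOp h2 hq hψ (Sum.elim 0 (vLast n K))
    (one_mul (-1 : K))), normalizedOp]
  set T := transvectionOp ψ (Sum.elim 0 (vLast n K)) 1 with hT
  set r := detOn (yMinus n K F) T / detOn (yPlus n K F ⊔ yZero n K F) T with hr
  congr 1
  obtain ⟨g, hg⟩ := exists_mulVec_uLast (n := n) (K := K)
  set P := weilRep (n := n) h2 hq hψ with hP
  have h1 : P (transvection (Sum.elim 0 (vLast n K)) (-1)) = r • T :=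
    weilRep_eq h2 hq hψ (isIntertwiner_transvectionOp h2 hq hψ _ (one_mul (-1 : K)))
  -- `ρ_{vₙ,-1}` is the conjugate by `g` of `ρ_{uₙ,-1}`, whose diagonal operator fixes `ε_0`.
  have h3 : P (transvection (Sum.elim 0 (vLast n K)) (-1)) (P g (eps F 0)) = P g (eps F 0) := by
    rw [← hg, ← conj_transvection, ← Module.End.mul_apply, ← map_mul, inv_mul_cancel_right,
      map_mul, Module.End.mul_apply, hP, weilRep_transvection_uLast, diagOp_eps, Pi.zero_apply,
      zero_pow two_ne_zero, mul_zero, AddChar.map_zero_eq_one, one_smul]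
  -- Each `J(0, βvₙ)` fixes `P(g) ε_0`, because `J(0, βuₙ)` fixes `ε_0`.
  have h4 : T (P g (eps F 0)) = (∑ β : K, ψ (β ^ 2)) • P g (eps F 0) := by
    rw [hT, transvectionOp, LinearMap.sum_apply, Finset.sum_smul]
    refine Finset.sum_congr rfl fun β _ => ?_
    rw [LinearMap.smul_apply, one_mul, ← hg, ← mulVec_smul, ← Module.End.mul_apply,
      ← weilRep_mul_heisenbergOp, Module.End.mul_apply, heisenbergOp_smul_uLast_eps_zero]
  rw [h1, LinearMap.smul_apply, h4, smul_smul] at h3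
  have h5 : P g (eps F 0) ≠ 0 := by
    intro h
    have h' := congrArg (P g⁻¹) h
    rw [← Module.End.mul_apply, ← map_mul, inv_mul_cancel, map_one, map_zero] at h'
    exact eps_ne_zero _ h'
  have h6 : r * ∑ β : K, ψ (β ^ 2) = 1 := by
    by_contra h
    refine h5 ((smul_eq_zero.1 ?_).resolve_left (sub_ne_zero.2 h))
    rw [sub_smul, h3, one_smul, sub_self]
  exact eq_inv_of_mul_eq_one_left h6

theorem isWeilRepresentation_weilRep (h2 : (2 : K) ≠ 0) (hq : (Fintype.card K : F) ≠ 0)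
    (hψ : ψ ≠ 1) : IsWeilRepresentation ψ (weilRep (n := n) h2 hq hψ) where
  conj g α x := by
    rw [weilRep_mul_heisenbergOp, mul_assoc, ← map_mul, mul_inv_cancel, map_one, mul_one]
  transvection_eps w := by
    rw [weilRep_transvection_vLast, LinearMap.smul_apply, transvectionOp, LinearMap.sum_apply]
    refine congrArg _ (Finset.sum_congr rfl fun β _ => ?_)
    rw [LinearMap.smul_apply, one_mul, heisenbergOp_smul_vLast_eps]

theorem IsWeilRepresentation.mul_heisenbergOp
    {P : Representation F (symplecticGroup (Fin n) K) (SpaceY n K F)}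
    (hP : IsWeilRepresentation ψ P) (g : symplecticGroup (Fin n) K) (α : K) (x : SpaceV n K) :
    P g * heisenbergOp ψ α x = heisenbergOp ψ α (g.1 *ᵥ x) * P g := by
  rw [← hP.conj, mul_assoc, ← map_mul, inv_mul_cancel, map_one, mul_one]

/-- There is at most one Weil representation of a given type. -/
theorem IsWeilRepresentation.unique (h2 : (2 : K) ≠ 0) (hψ : ψ ≠ 1)
    {P Q : Representation F (symplecticGroup (Fin n) K) (SpaceY n K F)}
    (hP : IsWeilRepresentation ψ P) (hQ : IsWeilRepresentation ψ Q) : P = Q := by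
  have hprop : ∀ g, ∃ c : F, c ≠ 0 ∧ Q g = c • P g := fun g =>
    exists_eq_smul_of_mul_heisenbergOp h2 hψ ((Group.isUnit g).map P)
      (hP.mul_heisenbergOp g 0) ((Group.isUnit g).map Q) (hQ.mul_heisenbergOp g 0)
  -- `P g` and `Q g` are proportional, and the scalar cancels in a conjugation.
  have hconj : ∀ g h, P h = Q h → P (g * h * g⁻¹) = Q (g * h * g⁻¹) := by
    intro g h hh
    obtain ⟨c, hc, e⟩ := hprop g
    have e' : Q g⁻¹ = c⁻¹ • P g⁻¹ := by
      have h1 : Q g⁻¹ * Q g = 1 := by rw [← map_mul, inv_mul_cancel, map_one]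
      have h2 : Q g * (c⁻¹ • P g⁻¹) = 1 := by
        rw [e, smul_mul_smul_comm, mul_inv_cancel₀ hc, one_smul, ← map_mul, mul_inv_cancel, map_one]
      exact left_inv_eq_right_inv h1 h2
    rw [map_mul, map_mul, map_mul, map_mul, e, e', hh, smul_mul_assoc, smul_mul_smul_comm,
      mul_inv_cancel₀ hc, one_smul]
  -- Here the prescribed value at `ρ` enters: for `u ≠ 0`, `ρ_{u,-1}` is conjugate to `ρ_{vₙ,-1}`.
  have h1 : ∀ u : SpaceV n K, P (transvection u (-1)) = Q (transvection u (-1)) := by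
    intro u
    by_cases hu : u = 0
    · rw [hu, transvection_zero_left, map_one, map_one]
    · obtain ⟨g, hg⟩ := exists_symplectic_mulVec_eq (x := Sum.elim 0 (vLast n K)) (y := u)
        (fun h => vLast_ne_zero (funext fun i => congrFun h (Sum.inr i))) hu
      rw [← hg, ← conj_transvection]
      refine hconj g _ (lhom_ext_eps fun w => ?_)
      rw [hP.transvection_eps, hQ.transvection_eps]
  have hall : ∀ g, P g = Q g := by
    intro g
    have hg : g ∈ transvectionSubgroup n K := by
      rw [transvectionSubgroup_eq_top]; exact Subgroup.mem_top g
    induction hg using Subgroup.closure_induction with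
    | mem g hg =>
      obtain ⟨u, α, rfl⟩ := hg
      obtain ⟨a, b, hab⟩ := exists_sq_add_sq_eq h2 (-α)
      have hα : α = -1 * a ^ 2 + -1 * b ^ 2 := by linear_combination hab
      rw [hα, transvection_add, map_mul, map_mul, ← transvection_smul, ← transvection_smul, h1, h1]
    | one => rw [map_one, map_one]
    | mul g h _ _ hg hh => rw [map_mul, map_mul, hg, hh]
    | inv g _ hg =>
      have h1 : P g⁻¹ * P g = 1 := by rw [← map_mul, inv_mul_cancel, map_one]
      have h2 : P g * Q g⁻¹ = 1 := by rw [hg, ← map_mul, mul_inv_cancel, map_one]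
      exact left_inv_eq_right_inv h1 h2
  exact MonoidHom.ext hall

end WeilRepresentation

/-! ### Isomorphisms between Weil modules of different types -/

section Scaling

variable {n : ℕ} {K F : Type*} [Field K] [Field F] {ψ : AddChar K F}

/-- The operator `ε_w ↦ ε_{a w}`. -/
def scaleOp (n : ℕ) {K : Type*} (F : Type*) [Field K] [Field F] (a : K) :
    Module.End F (SpaceY n K F) :=
  Finsupp.linearCombination F fun w => eps F (a • w)

theorem scaleOp_eps (a : K) (w : SpaceN n K) : scaleOp n F a (eps F w) = eps F (a • w) :=
  linearCombination_eps _ w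

theorem scaleOp_mul (a b : K) : scaleOp n F a * scaleOp n F b = scaleOp n F (a * b) :=
  lhom_ext_eps fun w => by
    rw [Module.End.mul_apply, scaleOp_eps, scaleOp_eps, scaleOp_eps, smul_smul]

theorem scaleOp_one : scaleOp n F (1 : K) = 1 :=
  lhom_ext_eps fun w => by rw [scaleOp_eps, one_smul]; rfl

theorem scaleOp_inv_mul {a : K} (ha : a ≠ 0) : scaleOp n F a⁻¹ * scaleOp n F a = 1 := by
  rw [scaleOp_mul, inv_mul_cancel₀ ha, scaleOp_one]

theorem scaleOp_mul_inv {a : K} (ha : a ≠ 0) : scaleOp n F a * scaleOp n F a⁻¹ = 1 := by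
  rw [scaleOp_mul, mul_inv_cancel₀ ha, scaleOp_one]

/-- `(α, x) ↦ (a²α, ax)` is, for `a ≠ 0`, an automorphism of the Heisenberg group commuting with
`Sp`; it turns type `ψ` into type `ψ[a²]`. -/
theorem scaleOp_mul_heisenbergOp (a α : K) (x : SpaceV n K) :
    scaleOp n F a * heisenbergOp (ψ.mulShift (a ^ 2)) α x =
      heisenbergOp ψ (a ^ 2 * α) (a • x) * scaleOp n F a := by
  refine lhom_ext_eps fun w => ?_
  have h1 : (a • x) ∘ Sum.inl = a • (x ∘ Sum.inl) := rfl
  have h2 : (a • x) ∘ Sum.inr = a • (x ∘ Sum.inr) := rfl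
  have h3 : a • (x ∘ Sum.inr) + 2 • a • w = a • (x ∘ Sum.inr + 2 • w) := by module
  rw [Module.End.mul_apply, Module.End.mul_apply, heisenbergOp_eps, map_smul, scaleOp_eps,
    scaleOp_eps, heisenbergOp_eps, AddChar.mulShift_apply, h1, h2, h3, smul_dotProduct,
    dotProduct_smul, smul_add, smul_eq_mul, smul_eq_mul, mul_add, ← mul_assoc a a, ← pow_two]

theorem heisenbergOp_mul_scaleOp_inv {a : K} (ha : a ≠ 0) (α : K) (x : SpaceV n K) :
    scaleOp n F a⁻¹ * heisenbergOp ψ (a ^ 2 * α) (a • x) =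
      heisenbergOp (ψ.mulShift (a ^ 2)) α x * scaleOp n F a⁻¹ := by
  rw [← mul_one (heisenbergOp ψ (a ^ 2 * α) (a • x)), ← scaleOp_mul_inv ha, ← mul_assoc,
    ← mul_assoc, mul_assoc (scaleOp n F a⁻¹), ← scaleOp_mul_heisenbergOp, ← mul_assoc,
    scaleOp_inv_mul ha, one_mul]

theorem scaleOp_mem_yMinus {a : K} (ha : a ≠ 0) :
    ∀ y ∈ yMinus n K F, scaleOp n F a y ∈ yMinus n K F := by
  change yMinus n K F ≤ (yMinus n K F).comap (scaleOp n F a)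
  refine Submodule.span_le.2 ?_
  rintro _ ⟨w, hw, rfl⟩
  refine Submodule.subset_span ⟨a • w, smul_ne_zero ha hw, ?_⟩
  rw [map_sub, scaleOp_eps, scaleOp_eps, smul_neg]

theorem scaleOp_mem_yPlus_sup_yZero {a : K} (ha : a ≠ 0) :
    ∀ y ∈ yPlus n K F ⊔ yZero n K F, scaleOp n F a y ∈ yPlus n K F ⊔ yZero n K F := by
  change yPlus n K F ⊔ yZero n K F ≤ (yPlus n K F ⊔ yZero n K F).comap (scaleOp n F a)
  refine sup_le (Submodule.span_le.2 ?_) (Submodule.span_le.2 ?_)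
  · rintro _ ⟨w, hw, rfl⟩
    refine Submodule.mem_sup_left (Submodule.subset_span ⟨a • w, smul_ne_zero ha hw, ?_⟩)
    rw [map_add, scaleOp_eps, scaleOp_eps, smul_neg]
  · rintro _ rfl
    refine Submodule.mem_sup_right (Submodule.subset_span ?_)
    rw [scaleOp_eps, smul_zero]
    rfl

/-- The conjugate of a representation on `Y` by the operator `ε_w ↦ ε_{a w}`. -/
def scaledRep (P : Representation F (symplecticGroup (Fin n) K) (SpaceY n K F)) {a : K}
    (ha : a ≠ 0) : Representation F (symplecticGroup (Fin n) K) (SpaceY n K F) where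
  toFun g := scaleOp n F a⁻¹ * P g * scaleOp n F a
  map_one' := by rw [map_one, mul_one, scaleOp_inv_mul ha]
  map_mul' g h := by
    rw [map_mul, mul_assoc (_ * P g), ← mul_assoc (scaleOp n F a), ← mul_assoc (scaleOp n F a),
      scaleOp_mul_inv ha, one_mul, ← mul_assoc, ← mul_assoc]

variable [Fintype K] [NeZero n]

theorem IsWeilRepresentation.scaledRep
    {P : Representation F (symplecticGroup (Fin n) K) (SpaceY n K F)}
    (hP : IsWeilRepresentation ψ P) {a : K} (ha : a ≠ 0) :
    IsWeilRepresentation (ψ.mulShift (a ^ 2)) (scaledRep P ha) where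
  conj g α x := by
    have h : WeilModules.scaledRep P ha g * heisenbergOp (ψ.mulShift (a ^ 2)) α x =
        heisenbergOp (ψ.mulShift (a ^ 2)) α (g.1 *ᵥ x) * WeilModules.scaledRep P ha g := by
      change scaleOp n F a⁻¹ * P g * scaleOp n F a * _ = _ * (scaleOp n F a⁻¹ * P g * scaleOp n F a)
      rw [mul_assoc, scaleOp_mul_heisenbergOp, mul_assoc, ← mul_assoc (P g), hP.mul_heisenbergOp,
        mulVec_smul, ← mul_assoc, ← mul_assoc, heisenbergOp_mul_scaleOp_inv ha, mul_assoc,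
        mul_assoc, ← mul_assoc (scaleOp n F a⁻¹)]
    rw [h, mul_assoc, ← map_mul, mul_inv_cancel, map_one, mul_one]
  transvection_eps w := by
    change scaleOp n F a⁻¹ (P _ (scaleOp n F a (eps F w))) = _
    rw [scaleOp_eps, hP.transvection_eps, map_smul, map_sum]
    -- `a²β² = (aβ)²`, so a square shift leaves the Gauss sum unchanged.
    have h1 : ∑ β : K, ψ.mulShift (a ^ 2) (β ^ 2) = ∑ β : K, ψ (β ^ 2) :=
      Fintype.sum_equiv (Equiv.mulLeft₀ a ha) _ _ fun β => by
        rw [AddChar.mulShift_apply, ← mul_pow]; rfl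
    rw [h1]
    refine congrArg _ (Fintype.sum_equiv (Equiv.mulLeft₀ a ha) _ _ fun β => ?_).symm
    rw [AddChar.mulShift_apply, show Equiv.mulLeft₀ a ha β = a * β from rfl, mul_pow, map_smul,
      scaleOp_eps, smul_add, smul_smul, smul_smul, ← mul_assoc, inv_mul_cancel₀ ha, one_mul,
      one_smul]

theorem WeilModule.iso_of_type_eq_mulShift_sq (h2 : (2 : K) ≠ 0)
    {W : Submodule F (SpaceY n K F)} (hW : ∀ a : K, a ≠ 0 → ∀ y ∈ W, scaleOp n F a y ∈ W)
    (A B : WeilModule W) {a : K} (ha : a ≠ 0) (h : B.type = A.type.mulShift (a ^ 2)) :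
    A.Iso B := by
  obtain ⟨ψ, hψ, P, hP, ⟨W, hs⟩, rfl⟩ := A
  obtain ⟨χ, hχ, Q, hQ, ⟨W', hs'⟩, hW'⟩ := B
  change W' = W at hW'
  change ∀ a : K, a ≠ 0 → ∀ y ∈ W, scaleOp n F a y ∈ W at hW
  change χ = ψ.mulShift (a ^ 2) at h
  subst hW' h
  -- By uniqueness the representation of `B` is the scaled one, so `ε_w ↦ ε_{a⁻¹w}` is the
  -- isomorphism.
  obtain rfl := hQ.unique h2 hχ (hP.scaledRep ha)
  have e1 : ∀ y, scaleOp n F a⁻¹ (scaleOp n F a y) = y :=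
    LinearMap.congr_fun (scaleOp_inv_mul ha)
  have e2 : ∀ y, scaleOp n F a (scaleOp n F a⁻¹ y) = y :=
    LinearMap.congr_fun (scaleOp_mul_inv ha)
  refine ⟨Representation.Equiv.mk (LinearEquiv.ofLinearMap
    ((scaleOp n F a⁻¹).restrict (hW _ (inv_ne_zero ha))) ((scaleOp n F a).restrict (hW a ha))
    (LinearMap.ext fun y => Subtype.ext (e1 y.1)) (LinearMap.ext fun y => Subtype.ext (e2 y.1)))
    fun g => LinearMap.ext fun y => Subtype.ext ?_⟩
  change scaleOp n F a⁻¹ (P g y.1) = scaleOp n F a⁻¹ (P g (scaleOp n F a (scaleOp n F a⁻¹ y.1)))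
  rw [e2]

theorem IsWeilRepresentation.apply_transvection_uLast (h2 : (2 : K) ≠ 0)
    (hq : (Fintype.card K : F) ≠ 0) (hψ : ψ ≠ 1)
    {P : Representation F (symplecticGroup (Fin n) K) (SpaceY n K F)}
    (hP : IsWeilRepresentation ψ P) (α : K) : P (transvection (uLast n K) α) =
      diagOp fun w : SpaceN n K => ψ (α * w ⊤ ^ 2) := by
  rw [hP.unique h2 hψ (isWeilRepresentation_weilRep h2 hq hψ), weilRep_transvection_uLast]

/-- The vector `y` is an eigenvector of all `ρ_{uₙ,α}` with eigenvalues `A.type α`, and so is its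
image. Where that image has a nonzero coordinate `w`, the eigenvalue must equal `A.type (κ α wₙ²)`,
which forces `κ wₙ² = 1`. -/
theorem WeilModule.isSquare_of_iso (h2 : (2 : K) ≠ 0) (hq : (Fintype.card K : F) ≠ 0)
    {W : Submodule F (SpaceY n K F)} {y : SpaceY n K F} (hyW : y ∈ W) (hy0 : y ≠ 0)
    (hy : ∀ w, y w ≠ 0 → w ⊤ ^ 2 = 1) (A B : WeilModule W) {κ : K}
    (h : B.type = A.type.mulShift κ) (hAB : A.Iso B) : IsSquare κ := by
  obtain ⟨f⟩ := hAB
  have hyA : y ∈ A.sub.toSubmodule := by rwa [A.sub_eq]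
  set z := f ⟨y, hyA⟩ with hz
  have hz0 : z.1 ≠ 0 := by
    intro e
    have : f ⟨y, hyA⟩ = 0 := Subtype.ext e
    exact hy0 (congrArg Subtype.val ((map_eq_zero_iff f (EquivLike.injective f)).1 this))
  have key : ∀ α : K, B.rep (transvection (uLast n K) α) z.1 = A.type α • z.1 := by
    intro α
    have h1 : A.sub.toRepresentation (transvection (uLast n K) α) ⟨y, hyA⟩ =
        A.type α • (⟨y, hyA⟩ : A.sub.toSubmodule) := by
      refine Subtype.ext ?_
      change A.rep (transvection (uLast n K) α) y = A.type α • y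
      rw [A.isWeil.apply_transvection_uLast h2 hq A.type_ne_one]
      ext w
      rw [diagOp_apply, Finsupp.smul_apply, smul_eq_mul]
      by_cases hw : y w = 0
      · rw [hw, mul_zero, mul_zero]
      · rw [hy w hw, mul_one]
    have h3 := Representation.IntertwiningMap.isIntertwining _ _ f.toIntertwiningMap
      (transvection (uLast n K) α) (⟨y, hyA⟩ : A.sub.toSubmodule)
    rw [h1, map_smul] at h3
    exact (congrArg Subtype.val h3).symm
  obtain ⟨w, hw⟩ := Finsupp.ne_iff.1 hz0
  have hsq : κ * w ⊤ ^ 2 = 1 := by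
    by_contra hne
    obtain ⟨s, hs⟩ := exists_apply_mul_ne_one A.type_ne_one (sub_ne_zero.2 hne)
    refine hs ?_
    have h4 := DFunLike.congr_fun (key s) w
    rw [B.isWeil.apply_transvection_uLast h2 hq B.type_ne_one, h, diagOp_apply, Finsupp.smul_apply,
      smul_eq_mul, AddChar.mulShift_apply] at h4
    have h5 := mul_right_cancel₀ hw h4
    have h6 : (κ * w ⊤ ^ 2 - 1) * s = κ * (s * w ⊤ ^ 2) - s := by ring
    rw [h6, AddChar.map_sub_eq_div, h5, div_self (AddChar.val_isUnit _ _).ne_zero]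
  exact ⟨(w ⊤)⁻¹, by
    have : w ⊤ ≠ 0 := fun e => by simp [e] at hsq
    field_simp
    exact hsq⟩

end Scaling

/-! ### Characters of the additive group of `K` -/

section Characters

variable {K F : Type*} [Field K] [Fintype K] [Field F]

/-- Every linear character is a multiplicative shift of a given non-trivial one. -/
theorem exists_eq_mulShift {ψ : AddChar K F} (hψ : ψ ≠ 1) (χ : AddChar K F) :
    ∃ κ, χ = ψ.mulShift κ := by
  have hli : LinearIndependent F fun χ : AddChar K F => (χ : K → F) :=
    (linearIndependent_monoidHom (Multiplicative K) F).comp _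
      (AddChar.toMonoidHomEquiv (A := K) (M := F)).injective
  have : Finite (AddChar K F) := hli.finite
  let := Fintype.ofFinite (AddChar K F)
  -- Independent characters number at most the dimension `q` of the space of functions, and the `q`
  -- shifts of `ψ` are already distinct.
  have hcard : Nat.card (AddChar K F) ≤ Nat.card K := by
    have h := hli.fintype_card_le_finrank
    rwa [Module.finrank_fintype_fun_eq_card, ← Nat.card_eq_fintype_card,
      ← Nat.card_eq_fintype_card] at h
  obtain ⟨κ, hκ⟩ := ((AddChar.to_mulShift_inj_of_isPrimitive
    (AddChar.IsPrimitive.of_ne_one hψ)).bijective_of_nat_card_le hcard).2 χ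
  exact ⟨κ, hκ.symm⟩

theorem isSquare_div_of_not_isSquare {a b : K} (ha : ¬ IsSquare a)
    (hb : ¬ IsSquare b) : IsSquare (a / b) := by
  classical
  have hb0 : b ≠ 0 := fun h => hb (h ▸ IsSquare.zero)
  have ha0 : a ≠ 0 := fun h => ha (h ▸ IsSquare.zero)
  have h : quadraticChar K (a * b) = 1 := by
    rw [map_mul, (quadraticChar_neg_one_iff_not_isSquare).2 ha,
      (quadraticChar_neg_one_iff_not_isSquare).2 hb, neg_mul_neg, one_mul]
  obtain ⟨s, hs⟩ := (quadraticChar_one_iff_isSquare (mul_ne_zero ha0 hb0)).1 h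
  refine ⟨s / b, ?_⟩
  rw [div_mul_div_comm, ← hs, mul_div_mul_right _ _ hb0]

/-- The character is `x ↦ ζ ^ Tr(x)`, non-trivial because the trace to the prime field is
surjective. -/
theorem exists_addChar_ne_one (p : ℕ) [Fact p.Prime] [CharP K p]
    (hroot : ∃ ζ : F, ζ ^ p = 1 ∧ ζ ≠ 1) : ∃ ψ : AddChar K F, ψ ≠ 1 := by
  obtain ⟨ζ, hζ, hζ1⟩ := hroot
  let := ZMod.algebra K p
  obtain ⟨x, hx⟩ := Algebra.trace_surjective (ZMod p) K 1
  refine ⟨(AddChar.zmodChar p hζ).compAddMonoidHom (Algebra.trace (ZMod p) K).toAddMonoidHom,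
    AddChar.ne_one_iff.2 ⟨x, ?_⟩⟩
  have h1 : AddChar.zmodChar p hζ 1 = ζ := by
    have := AddChar.zmodChar_apply' hζ 1
    rwa [Nat.cast_one, pow_one] at this
  rw [AddChar.compAddMonoidHom_apply, LinearMap.toAddMonoidHom_coe, hx, h1]
  exact hζ1

theorem cast_card_ne_zero (p : ℕ) [Fact p.Prime] [CharP K p] (hF : ringChar F ≠ p) :
    (Fintype.card K : F) ≠ 0 := by
  obtain ⟨m, -, hm⟩ := FiniteField.card K p
  rw [hm, Nat.cast_pow]
  refine pow_ne_zero _ fun h => ?_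
  rcases (Nat.dvd_prime (Fact.out : p.Prime)).1 ((ringChar.spec F p).1 h) with h | h
  · have h' := ringChar.Nat.cast_ringChar (R := F)
    rw [h, Nat.cast_one] at h'
    exact one_ne_zero h'
  · exact hF h

end Characters

/-! ### Classification, uniformly for both degrees -/

section WeilModules

variable {n : ℕ} [NeZero n] {K F : Type*} [Field K] [Field F]

/-- Invariance of a subspace of `Y` under the Weil representations, under `ε_w ↦ ε_{a w}`, and an
eigenvector of the transvections `ρ_{uₙ,α}` for the eigenvalues `ψ(α)`. -/
structure IsWeilSubspace (W : Submodule F (SpaceY n K F)) : Prop where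
  apply_mem : ∀ T : Module.End F (SpaceY n K F), Commute T (reflection n K F) →
    ∀ y ∈ W, T y ∈ W
  scaleOp_mem : ∀ a : K, a ≠ 0 → ∀ y ∈ W, scaleOp n F a y ∈ W
  exists_vec : ∃ y ∈ W, y ≠ 0 ∧ ∀ w, y w ≠ 0 → w ⊤ ^ 2 = 1

theorem isWeilSubspace_yMinus (h2 : (2 : K) ≠ 0) : IsWeilSubspace (yMinus n K F) where
  apply_mem _ hT := apply_mem_yMinus hT
  scaleOp_mem _ ha := scaleOp_mem_yMinus ha
  exists_vec := by
    -- The support lies in `{vₙ, -vₙ}`, where the last coordinate is `±1`. The coordinate at `vₙ` is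
    -- 1 because `vₙ ≠ -vₙ`.
    refine ⟨eps F (vLast n K) - eps F (-vLast n K), Submodule.subset_span ⟨_, vLast_ne_zero, rfl⟩,
      fun h => ?_, fun w hw => ?_⟩
    · have h' := DFunLike.congr_fun h (vLast n K)
      rw [Finsupp.sub_apply, eps, eps, Finsupp.single_eq_same,
        Finsupp.single_eq_of_ne (neg_ne_self h2 vLast_ne_zero).symm, sub_zero] at h'
      exact one_ne_zero h'
    · by_cases h1 : eps F (vLast n K) w = 0
      · rw [Finsupp.sub_apply, h1, zero_sub, neg_ne_zero] at hw
        rw [eq_of_eps_apply_ne_zero hw]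
        simp [vLast]
      · rw [eq_of_eps_apply_ne_zero h1]
        simp [vLast]

variable [Fintype K]

theorem WeilModule.Iso.symm {W : Submodule F (SpaceY n K F)} {A B : WeilModule W}
    (h : A.Iso B) : B.Iso A :=
  h.map Representation.Equiv.symm

theorem isWeilSubspace_yPlus_sup_yZero (h2 : (2 : K) ≠ 0) :
    IsWeilSubspace (yPlus n K F ⊔ yZero n K F) where
  apply_mem _ hT := apply_mem_yPlus_sup_yZero h2 hT
  scaleOp_mem _ ha := scaleOp_mem_yPlus_sup_yZero ha
  exists_vec := by
    refine ⟨eps F (vLast n K) + eps F (-vLast n K),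
      Submodule.mem_sup_left (Submodule.subset_span ⟨_, vLast_ne_zero, rfl⟩),
      fun h => ?_, fun w hw => ?_⟩
    · have h' := DFunLike.congr_fun h (vLast n K)
      rw [Finsupp.add_apply, eps, eps, Finsupp.single_eq_same,
        Finsupp.single_eq_of_ne (neg_ne_self h2 vLast_ne_zero).symm, add_zero] at h'
      exact one_ne_zero h'
    · by_cases h1 : eps F (vLast n K) w = 0
      · rw [Finsupp.add_apply, h1, zero_add] at hw
        rw [eq_of_eps_apply_ne_zero hw]
        simp [vLast]
      · rw [eq_of_eps_apply_ne_zero h1]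
        simp [vLast]

namespace IsWeilSubspace

variable {W : Submodule F (SpaceY n K F)}

theorem exists_weilModule (hW : IsWeilSubspace W) (h2 : (2 : K) ≠ 0)
    (hq : (Fintype.card K : F) ≠ 0) {ψ : AddChar K F} (hψ : ψ ≠ 1) :
    ∃ A : WeilModule W, A.type = ψ :=
  ⟨⟨ψ, hψ, weilRep h2 hq hψ, isWeilRepresentation_weilRep h2 hq hψ,
    ⟨W, fun g y hy => hW.apply_mem _ (weilRep_commute_reflection h2 hq hψ g) y hy⟩, rfl⟩, rfl⟩

theorem iso_iff (hW : IsWeilSubspace W) (h2 : (2 : K) ≠ 0) (hq : (Fintype.card K : F) ≠ 0)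
    {κ : K} (hκ : κ ≠ 0) (A B : WeilModule W) (h : B.type = A.type.mulShift κ) :
    A.Iso B ↔ IsSquare κ := by
  constructor
  · obtain ⟨y, hyW, hy0, hy⟩ := hW.exists_vec
    exact A.isSquare_of_iso h2 hq hyW hy0 hy B h
  · rintro ⟨a, rfl⟩
    rw [← pow_two] at h
    exact A.iso_of_type_eq_mulShift_sq h2 hW.scaleOp_mem B (left_ne_zero_of_mul hκ) h

theorem exists_two_classes (hW : IsWeilSubspace W) (h2 : (2 : K) ≠ 0)
    (hq : (Fintype.card K : F) ≠ 0) {ψ : AddChar K F} (hψ : ψ ≠ 1) :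
    ∃ A B : WeilModule W, ¬ A.Iso B ∧ ∀ C : WeilModule W, C.Iso A ∨ C.Iso B := by
  obtain ⟨κ, hκ⟩ := FiniteField.exists_nonsquare (ringChar_ne_two h2)
  have hκ0 : κ ≠ 0 := fun h => hκ (h ▸ IsSquare.zero)
  obtain ⟨A, rfl⟩ := hW.exists_weilModule h2 hq hψ
  -- The second class has type `ψ[κ]` with `κ` a nonsquare; a type `ψ[c]` with `c` a nonsquare
  -- differs from it by the square `c / κ`.
  obtain ⟨B, hB⟩ := hW.exists_weilModule h2 hq (AddChar.IsPrimitive.of_ne_one hψ hκ0)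
  refine ⟨A, B, fun h => hκ ((hW.iso_iff h2 hq hκ0 A B hB).1 h), fun C => ?_⟩
  obtain ⟨c, hc⟩ := exists_eq_mulShift hψ C.type
  have hc0 : c ≠ 0 := fun h => C.type_ne_one (by rw [hc, h, AddChar.mulShift_zero])
  by_cases hs : IsSquare c
  · exact Or.inl ((hW.iso_iff h2 hq hc0 A C hc).2 hs).symm
  · refine Or.inr ((hW.iso_iff h2 hq (div_ne_zero hc0 hκ0) B C ?_).2 ?_).symm
    · rw [hc, hB, AddChar.mulShift_mulShift, mul_div_cancel₀ _ hκ0]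
    · exact isSquare_div_of_not_isSquare hs hκ

end IsWeilSubspace

end WeilModules

end WeilModules

end

/-! ### The theorem -/

theorem mainTheorem10 (n : ℕ) [NeZero n] (p : ℕ) [Fact p.Prime] (hp : p ≠ 2)
    (K : Type*) [Field K] [Fintype K] [CharP K p]
    (F : Type*) [Field F] (hF : ringChar F ≠ p) (hroot : ∃ ζ : F, ζ ^ p = 1 ∧ ζ ≠ 1) :
    -- the Weil representation and the Weil modules of each type exist
    (∀ ψ : AddChar K F, ψ ≠ 1 →
      (∃! P : Representation F (Matrix.symplecticGroup (Fin n) K) (WeilModules.SpaceY n K F),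
        WeilModules.IsWeilRepresentation ψ P) ∧
      (∃ A : WeilModules.WeilModuleMinus n K F, A.type = ψ) ∧
      (∃ A : WeilModules.WeilModulePlus n K F, A.type = ψ)) ∧
    -- their degrees
    (∀ A : WeilModules.WeilModuleMinus n K F,
      Module.finrank F A.sub.toSubmodule = (Fintype.card K ^ n - 1) / 2) ∧
    (∀ A : WeilModules.WeilModulePlus n K F,
      Module.finrank F A.sub.toSubmodule = (Fintype.card K ^ n + 1) / 2) ∧
    -- exactly two isomorphism types of each degree
    (∃ A B : WeilModules.WeilModuleMinus n K F, ¬ A.Iso B ∧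
      ∀ C : WeilModules.WeilModuleMinus n K F, C.Iso A ∨ C.Iso B) ∧
    (∃ A B : WeilModules.WeilModulePlus n K F, ¬ A.Iso B ∧
      ∀ C : WeilModules.WeilModulePlus n K F, C.Iso A ∨ C.Iso B) ∧
    -- the types `ψ` and `ψ[κ]` are isomorphic if and only if `κ` is a square
    (∀ κ : K, κ ≠ 0 → ∀ A B : WeilModules.WeilModuleMinus n K F,
      B.type = A.type.mulShift κ → (A.Iso B ↔ IsSquare κ)) ∧
    (∀ κ : K, κ ≠ 0 → ∀ A B : WeilModules.WeilModulePlus n K F,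
      B.type = A.type.mulShift κ → (A.Iso B ↔ IsSquare κ)) := by
  have h2 : (2 : K) ≠ 0 := by
    refine Ring.two_ne_zero fun h => hp ?_
    rw [← h, ringChar.eq K p]
  have hq : (Fintype.card K : F) ≠ 0 := WeilModules.cast_card_ne_zero p hF
  have hm := WeilModules.isWeilSubspace_yMinus (n := n) (F := F) h2
  have hP := WeilModules.isWeilSubspace_yPlus_sup_yZero (n := n) (F := F) h2
  obtain ⟨ψ₀, hψ₀⟩ := WeilModules.exists_addChar_ne_one (K := K) p hroot
  have hcard := WeilModules.two_mul_card_halfSpace (n := n) h2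
  refine ⟨fun ψ hψ => ⟨⟨_, WeilModules.isWeilRepresentation_weilRep h2 hq hψ,
    fun P h => h.unique h2 hψ (WeilModules.isWeilRepresentation_weilRep h2 hq hψ)⟩,
    hm.exists_weilModule h2 hq hψ, hP.exists_weilModule h2 hq hψ⟩, fun A => ?_, fun A => ?_,
    hm.exists_two_classes h2 hq hψ₀, hP.exists_two_classes h2 hq hψ₀,
    fun _ hκ => hm.iso_iff h2 hq hκ, fun _ hκ => hP.iso_iff h2 hq hκ⟩
  · rw [A.sub_eq, WeilModules.finrank_yMinus h2]
    omega
  · rw [A.sub_eq, WeilModules.finrank_yPlus_sup_yZero h2]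
    omega
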